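/- Let $S^1=\mathbb{R}/\mathbb{Z}$. A \emph{multicritical circle map} is an orientation-preserving homeomorphism $f:S^1\to S^1$ of class $C^3$ having a finite number $N\ge 1$ of critical points (points where the derivative vanishes), each of which is \emph{non-flat}: for every critical point $c$ there are a real number $d>1$, a neighbourhood $W$ of $c$ and a $C^3$ diffeomorphism $\phi:W\to\phi(W)\subset\mathbb{R}$ with $\phi(c)=0$ such that $f(x)=f(c)+\phi(x)\,|\phi(x)|^{d-1}$ for all $x\in W$. The \emph{rotation number} $\rho(f)\in[0,1)$ is $\lim_{n\to\infty}(F^n(x)-x)/n$ modulo $1$, for any lift $F:\mathbb{R}\to\mathbb{R}$ of $f$ and any $x\in\mathbb{R}$. An irrational number is of \emph{bounded type} if the partial quotients of its continued fraction expansion are bounded. A homeomorphism $h:S^1\to S^1$ is \emph{quasisymmetric} if it preserves orientation and there is $K\ge 1$ such that, computing differences with a lift of $h$, $$\frac1K\;\le\;\frac{h(x+t)-h(x)}{h(x)-h(x-t)}\;\le\;K\qquad\text{for all } x \text{ and all } t>0 .$$ Let $f$ and $g$ be two multicritical circle maps (whose numbers of critical points, and whose criticalities $d$, may be different) with the same irrational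 rotation number, and suppose that this number is of bounded type. Then there is a quasisymmetric homeomorphism $h:S^1\to S^1$ with $h\circ f=g\circ h$. Moreover, every homeomorphism $h:S^1\to S^1$ with $h\circ f=g\circ h$ is quasisymmetric. -/

import Mathlib

/-! Orientation preserving homeomorphisms of the circle `ℝ / ℤ`, their lifts and rotation numbers,
multicritical circle maps, numbers of bounded type, and quasisymmetric homeomorphisms. -/

namespace CircleMap

/-- `F` is a lift to the real line of the circle homeomorphism `f`: a strictly increasing
continuous map with `F (x + 1) = F x + 1` that projects to `f`. -/
structure IsLift (F : CircleDeg1Lift) (f : UnitAddCircle ≃ₜ UnitAddCircle) : Prop where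
  continuous : Continuous F
  strictMono : StrictMono F
  coe_eq : ∀ x : ℝ, ((F x : ℝ) : UnitAddCircle) = f (x : UnitAddCircle)

/-- A circle homeomorphism is orientation preserving if it has an increasing lift of degree one. -/
def IsOrientationPreserving (f : UnitAddCircle ≃ₜ UnitAddCircle) : Prop :=
  ∃ F : CircleDeg1Lift, IsLift F f

open Classical in
/-- The rotation number in `[0, 1)` of an orientation preserving circle homeomorphism: the
translation number `lim (F^n x - x) / n` of any lift `F`, reduced modulo one. (The value on
orientation reversing homeomorphisms is irrelevant.) -/
noncomputable def rotationNumber (f : UnitAddCircle ≃ₜ UnitAddCircle) : ℝ :=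
  if hf : IsOrientationPreserving f then Int.fract hf.choose.translationNumber else 0

/-- Two lifts of the same homeomorphism differ by an integer translation. -/
theorem IsLift.exists_int_eq {F G : CircleDeg1Lift} {f : UnitAddCircle ≃ₜ UnitAddCircle}
    (hF : IsLift F f) (hG : IsLift G f) : ∃ m : ℤ, ∀ x : ℝ, F x = m + G x := by
  have hmem : ∀ x : ℝ, F x - G x ∈ Set.range ((↑) : ℤ → ℝ) := by
    intro x
    have h : (((F x - G x : ℝ)) : UnitAddCircle) = 0 := by
      rw [AddCircle.coe_sub, hF.coe_eq, hG.coe_eq, sub_self]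
    obtain ⟨n, hn⟩ := (AddCircle.coe_eq_zero_iff (1 : ℝ)).1 h
    exact ⟨n, by simpa using hn⟩
  obtain ⟨m, hm⟩ := hmem 0
  have hcont : Continuous fun x : ℝ => F x - G x := hF.continuous.sub hG.continuous
  have hdisc : IsDiscrete (Set.range ((↑) : ℤ → ℝ)) :=
    ⟨Int.isClosedEmbedding_coe_real.isEmbedding.toHomeomorph.symm.isEmbedding.discreteTopology⟩
  refine ⟨m, fun x => ?_⟩
  have h := isPreconnected_univ.constant_of_mapsTo hdisc hcont.continuousOn
    (fun x _ => hmem x) (Set.mem_univ x) (Set.mem_univ 0)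
  linarith

/-- The rotation number does not depend on the lift. -/
theorem rotationNumber_eq {F : CircleDeg1Lift} {f : UnitAddCircle ≃ₜ UnitAddCircle}
    (hF : IsLift F f) : rotationNumber f = Int.fract F.translationNumber := by
  have hf : IsOrientationPreserving f := ⟨F, hF⟩
  rw [rotationNumber, dif_pos hf]
  obtain ⟨m, hm⟩ := hf.choose_spec.exists_int_eq hF
  have h1 : hf.choose = (CircleDeg1Lift.translate (Multiplicative.ofAdd (m : ℝ)) : CircleDeg1Lift)
      * F := by
    ext x
    simp [hm x]
  have h2 : Commute (CircleDeg1Lift.translate (Multiplicative.ofAdd (m : ℝ)) : CircleDeg1Lift)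
      F := by
    rw [CircleDeg1Lift.commute_iff_commute]
    intro x
    simp
  rw [h1, CircleDeg1Lift.translationNumber_mul_of_commute h2,
    CircleDeg1Lift.translationNumber_translate, Int.fract_intCast_add]

/-- `c` is a non-flat critical point of degree `d > 1` of the `C^3` map `F`: on a neighbourhood
`W` of `c` one has `F x = F c + φ x * |φ x| ^ (d - 1)`, where `φ` is a `C^3` diffeomorphism of `W`
onto `φ W` with `φ c = 0`. -/
def IsNonFlatCriticalPoint (F : ℝ → ℝ) (c d : ℝ) : Prop :=
  deriv F c = 0 ∧ 1 < d ∧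
    ∃ φ : OpenPartialHomeomorph ℝ ℝ,
      c ∈ φ.source ∧ φ c = 0 ∧
      ContDiffOn ℝ 3 φ φ.source ∧ ContDiffOn ℝ 3 φ.symm φ.target ∧
      ∀ x ∈ φ.source, F x = F c + φ x * |φ x| ^ (d - 1)

/-- The critical points on the circle of the map with lift `F`. -/
def criticalSet (F : CircleDeg1Lift) : Set UnitAddCircle :=
  {c | ∃ x : ℝ, (x : UnitAddCircle) = c ∧ deriv F x = 0}

/-- A multicritical circle map: an orientation preserving `C^3` circle homeomorphism with a finite
nonzero number of critical points, all of them non-flat. (Smoothness and criticality are read off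
a lift; they do not depend on it, as two lifts differ by an integer constant.) -/
def IsMulticritical (f : UnitAddCircle ≃ₜ UnitAddCircle) : Prop :=
  ∃ F : CircleDeg1Lift, IsLift F f ∧ ContDiff ℝ 3 F ∧
    (criticalSet F).Finite ∧ (criticalSet F).Nonempty ∧
    ∀ c : ℝ, deriv F c = 0 → ∃ d : ℝ, IsNonFlatCriticalPoint F c d

/-- A number is of bounded type if the partial quotients of its continued fraction expansion
are bounded. -/
def IsBoundedType (ρ : ℝ) : Prop :=
  ∃ A : ℝ, ∀ (n : ℕ) (a : ℝ), (GenContFract.of ρ).partDens.get? n = some a → a ≤ A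

/-- A quasisymmetric homeomorphism of the circle: it preserves orientation and, for some `K ≥ 1`,
the ratio `(h (x + t) - h x) / (h x - h (x - t))`, computed with a lift of `h`, lies in
`[1 / K, K]` for all `x` and all `t > 0`. -/
def IsQuasisymmetric (h : UnitAddCircle ≃ₜ UnitAddCircle) : Prop :=
  ∃ H : CircleDeg1Lift, IsLift H h ∧ ∃ K : ℝ, 1 ≤ K ∧ ∀ x t : ℝ, 0 < t →
    1 / K ≤ (H (x + t) - H x) / (H x - H (x - t)) ∧
      (H (x + t) - H x) / (H x - H (x - t)) ≤ K

/-- `h` is a topological conjugacy from `f` to `g`, that is, `h ∘ f = g ∘ h`. The homeomorphism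
`h` is not assumed to preserve orientation. -/
def IsConjugacy (h f g : UnitAddCircle ≃ₜ UnitAddCircle) : Prop :=
  ∀ x : UnitAddCircle, h (f x) = g (h x)

end CircleMap

/-! Write `h` for the semiconjugacy from a lift `F` of `f` to the translation by `α`. Since `α` is
badly approximable, for every `N` the points `i * α`, `i ≤ N`, are modulo one both `c / N`-separated
and `C / N`-dense. Take an interval whose `h`-image has length `O (1 / N)`: its first `N` iterates
under `F` cover every point of the circle a bounded number of times, so the sum of their lengths is
bounded.

Near each point `F` is, up to a `C^2` change of coordinates, a power map. Power maps contract
cross-ratios of points on one side of their centre and distort all others by a bounded factor, and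
finitely many centres suffice. Hence an iterate of order at most `N` multiplies the cross-ratios of
the interval by at most a constant `B`.

Now let `G` be a close return `x ↦ F^[q] x - p` with `q ≤ N`. Where its displacement `G x - x` is
minimal, the cross-ratio of an orbit segment is bounded below, and density of the orbit transports
this bound to every point. So the displacements of `G` at `x` and at `G x` are comparable; such `G`
exist at all scales, which says that `h` is a homeomorphism with quasisymmetric inverse.

Finally only rotations commute with an irrational rotation, so with linearizations `h` of `f` and
`h'` of `g` every conjugacy from `f` to `g` lifts to `h'⁻¹ ∘ (· + a) ∘ h`. -/

namespace CircleMap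

open Set Filter Topology

/-! ### Badly approximable numbers -/

section ContinuedFraction

open GenContFract

theorem exists_int_contsAux_eq (ξ : ℝ) (n : ℕ) :
    ∃ a b : ℤ, (GenContFract.of ξ).contsAux n = ⟨a, b⟩ := by
  induction n using Nat.twoStepInduction with
  | zero => exact ⟨1, 0, by simp [contsAux]⟩
  | one => exact ⟨⌊ξ⌋, 1, by simp [contsAux]⟩
  | more n hn hn' =>
    obtain ⟨a, b, hab⟩ := hn
    obtain ⟨a', b', hab'⟩ := hn'
    rcases hs : (GenContFract.of ξ).s.get? n with _ | gp
    · exact ⟨a', b', (contsAux_stable_of_terminated (n + 1).le_succ hs).trans hab'⟩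
    · obtain ⟨hgp, z, hz⟩ := of_partNum_eq_one_and_exists_int_partDen_eq hs
      refine ⟨z * a' + a, z * b' + b, ?_⟩
      rw [contsAux_recurrence hs hab hab', hgp, hz]
      push_cast
      simp only [one_mul]

variable {A ξ : ℝ}

theorem not_terminatedAt_of_irrational (hξ : Irrational ξ) (n : ℕ) :
    ¬ (GenContFract.of ξ).TerminatedAt n := fun h =>
  have ⟨q, hq⟩ := (terminates_iff_rat ξ).1 ⟨n, h⟩
  hξ ⟨q, hq.symm⟩

theorem one_le_dens (ξ : ℝ) (n : ℕ) : 1 ≤ (GenContFract.of ξ).dens n := by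
  induction n with
  | zero => simp
  | succ n ih => exact ih.trans of_den_mono

/-- The determinant formula makes the numerators and denominators of the convergents coprime, so
a fraction equal to the `n`-th convergent has denominator at least `dens n`. -/
theorem dens_le_of_convs_eq (hξ : Irrational ξ) {n : ℕ} {q : ℚ}
    (hq : (GenContFract.of ξ).convs n = q) : (GenContFract.of ξ).dens n ≤ q.den := by
  obtain ⟨a, b, hab⟩ := exists_int_contsAux_eq ξ (n + 1)
  obtain ⟨a', b', hab'⟩ := exists_int_contsAux_eq ξ (n + 2)
  have hdet := SimpContFract.determinant (s := SimpContFract.of ξ)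
    (not_terminatedAt_of_irrational hξ n)
  change (GenContFract.of ξ).nums n * (GenContFract.of ξ).dens (n + 1) -
    (GenContFract.of ξ).dens n * (GenContFract.of ξ).nums (n + 1) = (-1) ^ (n + 1) at hdet
  have hpos := one_le_dens ξ n
  simp only [convs, num_eq_conts_a, den_eq_conts_b, nth_cont_eq_succ_nth_contAux, hab, hab']
    at hq hdet hpos ⊢
  have hdiv : (q.num * b : ℝ) = a * q.den := by
    rw [Rat.cast_def, div_eq_div_iff (by positivity) (by positivity)] at hq
    exact hq.symm
  norm_cast at hdiv hpos ⊢
  have hdet' : a * b' - b * a' = (-1) ^ (n + 1) := by exact_mod_cast hdet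
  have hdvd : b ∣ q.den * (-1) ^ (n + 1) :=
    ⟨q.num * b' - q.den * a', by rw [← hdet']; linear_combination -b' * hdiv⟩
  exact Int.le_of_dvd (by exact_mod_cast q.pos)
    (((isUnit_one.neg.pow _).dvd_mul_right).1 hdvd)

theorem one_div_dens_sq_le_abs_sub_convs (hξ : Irrational ξ)
    (hA : ∀ (n : ℕ) (a : ℝ), (GenContFract.of ξ).partDens.get? n = some a → a ≤ A) (n : ℕ) :
    1 / ((A + 2) * (GenContFract.of ξ).dens n ^ 2) ≤ |ξ - (GenContFract.of ξ).convs n| := by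
  obtain ⟨ifp, hstream⟩ : ∃ ifp, IntFractPair.stream ξ n = some ifp := by
    refine Option.ne_none_iff_exists'.1 fun h => not_terminatedAt_of_irrational hξ n ?_
    exact of_terminatedAt_n_iff_succ_nth_intFractPair_stream_eq_none.2
      (IntFractPair.stream_isSeq ξ h)
  have hfr : ifp.fr ≠ 0 := fun h => not_terminatedAt_of_irrational hξ n <|
    of_terminatedAt_n_iff_succ_nth_intFractPair_stream_eq_none.2
      (IntFractPair.stream_eq_none_of_fr_eq_zero hstream h)
  have hfr0 : 0 < ifp.fr := (IntFractPair.nth_stream_fr_nonneg hstream).lt_of_ne' hfr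
  have hfrA : ifp.fr⁻¹ ≤ A + 1 :=
    (Int.lt_floor_add_one _).le.trans <| add_le_add_left (hA n _ <| partDen_eq_s_b <|
      get?_of_eq_some_of_get?_intFractPair_stream_fr_ne_zero hstream hfr) 1
  have hpos := one_le_dens ξ n
  have hpred : ((GenContFract.of ξ).contsAux n).b ≤ (GenContFract.of ξ).dens n := by
    cases n with
    | zero => simp [contsAux]
    | succ n => exact of_den_mono
  have hpred0 : 0 ≤ ((GenContFract.of ξ).contsAux n).b := zero_le_of_contsAux_b
  have hsub := sub_convs_eq hstream
  simp only [if_neg hfr, ← nth_cont_eq_succ_nth_contAux, ← den_eq_conts_b] at hsub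
  set B := (GenContFract.of ξ).dens n
  rw [hsub, abs_div, abs_pow, abs_neg, abs_one, one_pow, abs_of_pos (by positivity)]
  refine one_div_le_one_div_of_le (by positivity) ?_
  calc B * (ifp.fr⁻¹ * B + ((GenContFract.of ξ).contsAux n).b) ≤ B * ((A + 1) * B + B) := by gcongr
    _ = (A + 2) * B ^ 2 := by ring

end ContinuedFraction

/-- `α` is badly approximable with constant `c`: the distance from `q * α` to the integers is at
least `c / q` for every `q ≥ 1`. -/
def BadlyApproximableWith (c α : ℝ) : Prop :=
  ∀ (q : ℕ) (p : ℤ), 1 ≤ q → c / q ≤ |q * α - p|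

theorem IsBoundedType.exists_badlyApproximableWith {ξ : ℝ} (h : IsBoundedType ξ)
    (hξ : Irrational ξ) : ∃ c : ℝ, 0 < c ∧ BadlyApproximableWith c ξ := by
  obtain ⟨A, hA⟩ := h
  set C := max (A + 2) 2
  have hC : 2 ≤ C := le_max_right _ _
  have hrat (r : ℚ) : 1 / (C * (r.den : ℝ) ^ 2) ≤ |ξ - r| := by
    have : (1 : ℝ) ≤ r.den := by exact_mod_cast r.pos
    rcases lt_or_ge |ξ - r| (1 / (2 * (r.den : ℝ) ^ 2)) with hlt | hge
    · obtain ⟨n, hn⟩ := Real.exists_convs_eq_rat hlt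
      have hA' (m : ℕ) (a : ℝ) (ha : (GenContFract.of ξ).partDens.get? m = some a) : a ≤ C - 2 :=
        (hA m a ha).trans (by linarith [le_max_left (A + 2) 2])
      have hdens := one_le_dens ξ n
      calc 1 / (C * (r.den : ℝ) ^ 2) ≤ 1 / ((C - 2 + 2) * (GenContFract.of ξ).dens n ^ 2) := by
            rw [sub_add_cancel]
            gcongr
            exact dens_le_of_convs_eq hξ hn
        _ ≤ |ξ - r| := hn ▸ one_div_dens_sq_le_abs_sub_convs hξ hA' n
    · exact le_trans (by gcongr) hge
  refine ⟨1 / C, by positivity, fun q p hq => ?_⟩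
  have hq' : (0 : ℝ) < q := by exact_mod_cast hq
  have hden : (((p / q : ℚ).den : ℕ) : ℝ) ≤ q := by
    have hdvd := Rat.den_dvd p q
    rw [Rat.divInt_eq_div, Int.cast_natCast] at hdvd
    exact_mod_cast Int.le_of_dvd (by exact_mod_cast hq) hdvd
  have : (0 : ℝ) < (p / q : ℚ).den := by exact_mod_cast (p / q : ℚ).pos
  calc 1 / C / q = q * (1 / (C * (q : ℝ) ^ 2)) := by field_simp
    _ ≤ q * |ξ - (p / q : ℚ)| := by
        gcongr
        exact le_trans (by gcongr) (hrat _)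
    _ = |q * ξ - p| := by
        rw [← abs_of_pos hq', ← abs_mul, abs_of_pos hq']
        push_cast
        congr 1
        field_simp

namespace BadlyApproximableWith

variable {c α : ℝ}

theorem add_int (h : BadlyApproximableWith c α) (m : ℤ) : BadlyApproximableWith c (α + m) := by
  intro q p hq
  convert h q (p - q * m) hq using 2
  push_cast
  ring

/-- Distinct points of an orbit of the rotation by `α`, with times at most `N`, are
`c / N`-separated on the circle. -/
theorem le_abs_sub (h : BadlyApproximableWith c α) (hc : 0 ≤ c) {N i j : ℕ} (hi : i ≤ N)
    (hj : j ≤ N) (hij : i ≠ j) (p q : ℤ) : c / N ≤ |(i * α - p) - (j * α - q)| := by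
  wlog hlt : i < j generalizing i j p q
  · rw [abs_sub_comm]
    exact this hj hi hij.symm q p (by omega)
  have hsub : (0 : ℝ) < ((j - i : ℕ) : ℝ) := by exact_mod_cast Nat.sub_pos_of_lt hlt
  calc c / N ≤ c / ((j - i : ℕ) : ℝ) := by gcongr; omega
    _ ≤ |((j - i : ℕ) : ℝ) * α - ((q - p : ℤ) : ℝ)| := h _ _ (by omega)
    _ = |(i * α - p) - (j * α - q)| := by
      rw [abs_sub_comm (i * α - p)]
      push_cast [Nat.cast_sub hlt.le]
      congr 1
      ring

end BadlyApproximableWith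

theorem exists_natCast_mul_num_sub_eq (r : ℚ) (t : ℤ) :
    ∃ (i : ℕ) (p : ℤ), 1 ≤ i ∧ i ≤ r.den ∧ i * r.num - p * r.den = t := by
  obtain ⟨x, y, hxy⟩ : IsCoprime r.num (r.den : ℤ) := Int.isCoprime_iff_gcd_eq_one.2 r.reduced
  have hden : (0 : ℤ) < r.den := by exact_mod_cast r.pos
  have hnonneg := Int.emod_nonneg (x * t - 1) hden.ne'
  have hlt := Int.emod_lt_of_pos (x * t - 1) hden
  refine ⟨((x * t - 1) % r.den + 1).toNat, -(r.num * ((x * t - 1) / r.den)) - y * t,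
    by omega, by omega, ?_⟩
  rw [Int.toNat_of_nonneg (by omega)]
  linear_combination (r.num : ℤ) * Int.emod_add_mul_ediv (x * t - 1) r.den + t * hxy

/-- The first `N` points of an orbit of the rotation by `α` are `(2 + 1 / c) / N`-dense: they
are `1 / N`-close to the multiples of `1 / r.den`, where `r` is a Dirichlet approximation of `α`
with `r.den ≤ N`, and bad approximability makes `r.den` comparable to `N`. -/
theorem BadlyApproximableWith.exists_mem_Ioo {c α : ℝ} (h : BadlyApproximableWith c α)
    (hc : 0 < c) {N : ℕ} (hN : 1 ≤ N) (u : ℝ) :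
    ∃ (i : ℕ) (p : ℤ), 1 ≤ i ∧ i ≤ N ∧ (i * α - p : ℝ) ∈ Ioo u (u + (2 + 1 / c) / N) := by
  obtain ⟨r, hr, hrN⟩ := Real.exists_rat_abs_sub_le_and_den_le α (n := N) hN
  have : (0 : ℝ) < N := by exact_mod_cast hN
  have hden : (0 : ℝ) < r.den := by exact_mod_cast r.pos
  have hclose : r.den * |α - r| < 1 / N := by
    calc r.den * |α - r| ≤ r.den * (1 / ((N + 1) * r.den)) := by gcongr
      _ = 1 / (N + 1) := by field_simp
      _ < 1 / N := by gcongr; linarith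
  have hden_inv : 1 / (r.den : ℝ) < 1 / c / N := by
    have hlow : c / r.den < 1 / N := by
      refine (h r.den r.num r.pos).trans_lt (lt_of_eq_of_lt ?_ hclose)
      have hnum : (r : ℝ) * r.den = r.num := by exact_mod_cast Rat.mul_den_eq_num r
      rw [← hnum, mul_comm (r : ℝ), ← mul_sub, abs_mul, abs_of_pos hden]
    rw [div_lt_div_iff₀ hden (by positivity)] at hlow
    rw [div_div, div_lt_div_iff₀ hden (by positivity)]
    linarith
  set t : ℤ := ⌊(u + 1 / N) * r.den⌋ + 1 with ht
  have htu : u + 1 / N < t / r.den := by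
    rw [lt_div_iff₀ hden, ht]; push_cast; exact Int.lt_floor_add_one _
  have htu' : (t : ℝ) / r.den ≤ u + 1 / N + 1 / r.den := by
    rw [← sub_le_iff_le_add, ← sub_div, div_le_iff₀ hden, ht]; push_cast
    simpa using Int.floor_le ((u + 1 / N) * r.den)
  obtain ⟨i, p, hi, hir, hip⟩ := exists_natCast_mul_num_sub_eq r t
  have hip' : (i : ℝ) * r.num - p * r.den = t := by exact_mod_cast hip
  have horbit : (i : ℝ) * α - p = t / r.den + i * (α - r) := by
    rw [← hip', Rat.cast_def]
    field_simp
    ring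
  have herr : |i * (α - r)| < 1 / N := by
    rw [abs_mul, Nat.abs_cast]
    exact lt_of_le_of_lt (by gcongr) hclose
  obtain ⟨hlo, hhi⟩ := abs_lt.1 herr
  have hsplit : (2 + 1 / c) / N = 1 / N + 1 / N + 1 / c / N := by ring
  exact ⟨i, p, hi, hir.trans hrN, by rw [horbit]; linarith, by rw [horbit]; linarith⟩

theorem card_le_of_separated {ι : Type*} (s : Finset ι) (θ : ι → ℝ) {η u l : ℝ} (hη : 0 < η)
    (hl : 0 ≤ l) (hmem : ∀ i ∈ s, θ i ∈ Icc u (u + l))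
    (hsep : ∀ i ∈ s, ∀ j ∈ s, i ≠ j → η ≤ |θ i - θ j|) : (s.card : ℝ) ≤ l / η + 1 := by
  have hmaps : MapsTo (fun i => ⌊(θ i - u) / η⌋₊) s (Finset.range (⌊l / η⌋₊ + 1)) := by
    intro i hi
    obtain ⟨-, hi⟩ := hmem i hi
    simp only [Finset.coe_range, mem_Iio, Order.lt_add_one_iff]
    gcongr
    linarith
  have hinj : InjOn (fun i => ⌊(θ i - u) / η⌋₊) s := by
    intro i hi j hj hij
    by_contra hne
    have hfloor : ⌊(θ i - u) / η⌋ = ⌊(θ j - u) / η⌋ := by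
      rw [← Int.natCast_floor_eq_floor (div_nonneg (by linarith [(hmem i hi).1]) hη.le),
        ← Int.natCast_floor_eq_floor (div_nonneg (by linarith [(hmem j hj).1]) hη.le)]
      exact_mod_cast hij
    have hlt := Int.abs_sub_lt_one_of_floor_eq_floor hfloor
    rw [← sub_div, sub_sub_sub_cancel_right, abs_div, abs_of_pos hη, div_lt_one hη] at hlt
    exact (hsep i hi j hj hne).not_gt hlt
  have hcard := Finset.card_le_card_of_injOn _ hmaps hinj
  rw [Finset.card_range] at hcard
  calc (s.card : ℝ) ≤ ⌊l / η⌋₊ + 1 := by exact_mod_cast hcard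
    _ ≤ l / η + 1 := by gcongr; exact Nat.floor_le (by positivity)

/-! ### Power maps -/

/-- The signed power map `y ↦ y |y| ^ (d - 1)`, the local model of a critical point of
criticality `d`. -/
noncomputable def signedPow (d y : ℝ) : ℝ := y * |y| ^ (d - 1)

theorem signedPow_neg (d y : ℝ) : signedPow d (-y) = -signedPow d y := by
  simp [signedPow]

theorem signedPow_one (y : ℝ) : signedPow 1 y = y := by
  simp [signedPow]

theorem signedPow_exp (d x : ℝ) : signedPow d (Real.exp x) = Real.exp (x * d) := by
  rw [signedPow, abs_of_pos (Real.exp_pos x), ← Real.exp_mul, ← Real.exp_add]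
  ring_nf

theorem hasDerivAt_signedPow {d : ℝ} (hd : 1 ≤ d) (y : ℝ) :
    HasDerivAt (signedPow d) (d * |y| ^ (d - 1)) y := by
  rcases hd.eq_or_lt with rfl | hd
  · simpa [show signedPow 1 = id from funext signedPow_one] using hasDerivAt_id y
  rcases eq_or_ne y 0 with rfl | hy
  · have hlim : Tendsto (fun t : ℝ => |t| ^ (d - 1)) (𝓝[≠] 0) (𝓝 0) := by
      have hcont : Continuous fun t : ℝ => |t| ^ (d - 1) :=
        continuous_abs.rpow_const fun _ => Or.inr (by linarith)
      exact (hcont.tendsto' 0 0 (by simp [sub_ne_zero.2 hd.ne'])).mono_left inf_le_left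
    rw [abs_zero, Real.zero_rpow (sub_ne_zero.2 hd.ne'), mul_zero,
      hasDerivAt_iff_tendsto_slope_zero]
    refine hlim.congr' (eventually_mem_nhdsWithin.mono fun t ht => ?_)
    simp [signedPow, inv_mul_cancel_left₀ (show t ≠ 0 from ht)]
  · have habs : |y| ≠ 0 := abs_ne_zero.2 hy
    refine ((hasDerivAt_id y).mul ((hasDerivAt_abs hy).rpow_const (Or.inl habs))).congr_deriv ?_
    have hsign : y * SignType.sign y = |y| := by rw [mul_comm, sign_mul_self]
    rw [Real.rpow_sub_one habs (d - 1), id]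
    field_simp
    linear_combination (d - 1) * hsign

/-- With `w = max |u| |v|`, the average slope of a power map on `[u, v]` is comparable to its
maximal derivative `d * w ^ (d - 1)` there. -/
theorem max_rpow_mul_sub_le_signedPow_sub {d u v : ℝ} (hd : 1 ≤ d) (huv : u < v) :
    max |u| |v| ^ (d - 1) / 2 * (v - u) ≤ signedPow d v - signedPow d u := by
  wlog hmax : |u| ≤ |v| generalizing u v
  · have := this (u := -v) (v := -u) (by linarith) (by simpa using (not_le.1 hmax).le)
    rw [abs_neg, abs_neg, max_comm, signedPow_neg, signedPow_neg] at this
    linarith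
  have hv : 0 ≤ v := by
    by_contra! hv
    rw [abs_of_neg hv, abs_of_neg (huv.trans hv)] at hmax
    linarith
  have hpow : |u| ^ (d - 1) ≤ v ^ (d - 1) := by
    rw [abs_of_nonneg hv] at hmax
    gcongr
  rw [max_eq_right hmax, signedPow, signedPow, abs_of_nonneg hv]
  have : 0 ≤ |u| ^ (d - 1) := by positivity
  rcases le_total 0 u with hu | hu
  · nlinarith
  · rw [abs_of_nonneg hv, abs_of_nonpos hu] at hmax
    nlinarith

theorem strictMono_signedPow {d : ℝ} (hd : 1 ≤ d) : StrictMono (signedPow d) := by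
  intro u v huv
  have hmax : 0 < max |u| |v| := by
    rcases eq_or_ne u 0 with rfl | hu
    · exact lt_max_of_lt_right (abs_pos.2 huv.ne')
    · exact lt_max_of_lt_left (abs_pos.2 hu)
  have hpos : 0 < max |u| |v| ^ (d - 1) / 2 * (v - u) :=
    mul_pos (by positivity) (sub_pos.2 huv)
  linarith [max_rpow_mul_sub_le_signedPow_sub hd huv]

theorem slope_pos_of_strictMonoOn {f : ℝ → ℝ} {s : Set ℝ} (hf : StrictMonoOn f s) {u v : ℝ}
    (hu : u ∈ s) (hv : v ∈ s) (huv : u < v) : 0 < slope f u v := by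
  rw [slope_def_field]
  exact div_pos (sub_pos.2 (hf hu hv huv)) (sub_pos.2 huv)

theorem slope_pos_of_strictMono {f : ℝ → ℝ} (hf : StrictMono f) {u v : ℝ} (huv : u < v) :
    0 < slope f u v :=
  slope_pos_of_strictMonoOn (hf.strictMonoOn univ) (mem_univ u) (mem_univ v) huv

theorem slope_signedPow_le {d u v x y : ℝ} (hd : 1 ≤ d) (hux : u ≤ x) (hxy : x < y) (hyv : y ≤ v) :
    slope (signedPow d) x y ≤ 2 * d * slope (signedPow d) u v := by
  set w := max |u| |v|
  have hmem {t : ℝ} (hut : u ≤ t) (htv : t ≤ v) : t ∈ Icc (-w) w :=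
    abs_le.1 (abs_le_max_abs_abs hut htv)
  have hupper : slope (signedPow d) x y ≤ d * w ^ (d - 1) := by
    rw [slope_def_field, div_le_iff₀ (by linarith)]
    refine (convex_Icc (-w) w).image_sub_le_mul_sub_of_deriv_le
      (fun t _ => (hasDerivAt_signedPow hd t).continuousAt.continuousWithinAt)
      (fun t _ => (hasDerivAt_signedPow hd t).differentiableAt.differentiableWithinAt)
      (fun t ht => ?_) x (hmem hux (by linarith)) y (hmem (by linarith) hyv) hxy.le
    rw [(hasDerivAt_signedPow hd t).deriv]
    gcongr
    exact abs_le.2 (show t ∈ Icc (-w) w from interior_subset ht)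
  have hlower : w ^ (d - 1) / 2 ≤ slope (signedPow d) u v := by
    rw [slope_def_field, le_div_iff₀ (by linarith)]
    exact max_rpow_mul_sub_le_signedPow_sub hd (by linarith)
  calc slope (signedPow d) x y ≤ 2 * d * (w ^ (d - 1) / 2) := by linarith
    _ ≤ 2 * d * slope (signedPow d) u v := by gcongr

theorem sinh_mul_cosh_le_mul_cosh_mul_sinh {d x : ℝ} (hd : 1 ≤ d) (hx : 0 ≤ x) :
    Real.sinh (d * x) * Real.cosh x ≤ d * Real.cosh (d * x) * Real.sinh x := by
  have hderiv (t : ℝ) : HasDerivAt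
      (fun t => d * Real.cosh (d * t) * Real.sinh t - Real.sinh (d * t) * Real.cosh t)
      ((d ^ 2 - 1) * Real.sinh (d * t) * Real.sinh t) t := by
    have hmul := hasDerivAt_const_mul d (x := t)
    refine (((hmul.cosh.const_mul d).mul (Real.hasDerivAt_sinh t)).sub
      (hmul.sinh.mul (Real.hasDerivAt_cosh t))).congr_deriv ?_
    ring
  have hmono := monotoneOn_of_hasDerivWithinAt_nonneg (convex_Ici (0 : ℝ))
    (fun t _ => (hderiv t).continuousAt.continuousWithinAt)
    (fun t _ => (hderiv t).hasDerivWithinAt) fun t ht => by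
      have ht : 0 ≤ t := interior_subset ht
      have := Real.sinh_nonneg_iff.2 (mul_nonneg (by linarith : 0 ≤ d) ht)
      have := Real.sinh_nonneg_iff.2 ht
      have : 0 ≤ d ^ 2 - 1 := by nlinarith
      positivity
  simpa using hmono self_mem_Ici hx hx

theorem sinh_mul_sinh_le {d s t : ℝ} (hd : 1 ≤ d) (hs : 0 < s) (hst : s ≤ t) :
    Real.sinh (d * s) * Real.sinh t ≤ Real.sinh (d * t) * Real.sinh s := by
  have hpos {x : ℝ} (hx : 0 < x) : 0 < Real.sinh x := Real.sinh_pos_iff.2 hx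
  have hderiv (x : ℝ) (hx : 0 < x) : HasDerivAt (fun x => Real.sinh (d * x) / Real.sinh x)
      ((d * Real.cosh (d * x) * Real.sinh x - Real.sinh (d * x) * Real.cosh x)
        / Real.sinh x ^ 2) x := by
    refine ((hasDerivAt_const_mul d).sinh.div (Real.hasDerivAt_sinh x)
      (hpos hx).ne').congr_deriv ?_
    ring
  have hmono := monotoneOn_of_hasDerivWithinAt_nonneg (convex_Ioi (0 : ℝ))
    (fun x hx => (hderiv x hx).continuousAt.continuousWithinAt)
    (fun x hx => (hderiv x (interior_subset hx)).hasDerivWithinAt) fun x hx =>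
      div_nonneg (sub_nonneg.2 (sinh_mul_cosh_le_mul_cosh_mul_sinh hd
        (le_of_lt (interior_subset hx)))) (sq_nonneg _)
  exact (div_le_div_iff₀ (hpos hs) (hpos (hs.trans_le hst))).1 (hmono hs (hs.trans_le hst) hst)

theorem exp_sub_exp_mul_exp_sub_exp (x y z w : ℝ) :
    (Real.exp y - Real.exp x) * (Real.exp w - Real.exp z) =
      4 * Real.exp ((x + y + z + w) / 2) * (Real.sinh ((y - x) / 2) * Real.sinh ((w - z) / 2)) := by
  have hdiff (x y : ℝ) :
      Real.exp y - Real.exp x = 2 * Real.exp ((x + y) / 2) * Real.sinh ((y - x) / 2) := by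
    rw [Real.sinh_eq, mul_assoc, mul_div_assoc', mul_sub, ← Real.exp_add, ← Real.exp_add]
    ring_nf
  rw [hdiff, hdiff, show (x + y + z + w) / 2 = (x + y) / 2 + (z + w) / 2 by ring, Real.exp_add]
  ring

/-- In logarithmic coordinates both cross-ratios are quotients of hyperbolic sines, and
`sinh (d * s) / sinh s` is increasing in `s`. -/
theorem signedPow_sub_mul_sub_le {d a b c e : ℝ} (hd : 1 ≤ d) (ha : 0 < a) (hab : a < b)
    (hbc : b < c) (hce : c < e) :
    (signedPow d b - signedPow d a) * (signedPow d e - signedPow d c) * ((c - a) * (e - b)) ≤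
      (signedPow d c - signedPow d a) * (signedPow d e - signedPow d b) *
        ((b - a) * (e - c)) := by
  obtain ⟨a, rfl⟩ : a ∈ range Real.exp := Real.range_exp ▸ ha
  obtain ⟨b, rfl⟩ : b ∈ range Real.exp := Real.range_exp ▸ ha.trans hab
  obtain ⟨c, rfl⟩ : c ∈ range Real.exp := Real.range_exp ▸ ha.trans (hab.trans hbc)
  obtain ⟨e, rfl⟩ : e ∈ range Real.exp := Real.range_exp ▸ ha.trans (hab.trans (hbc.trans hce))
  rw [Real.exp_lt_exp] at hab hbc hce
  have hscale (x y : ℝ) : (y * d - x * d) / 2 = d * ((y - x) / 2) := by ring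
  have hleft := sinh_mul_sinh_le (s := (b - a) / 2) (t := (c - a) / 2) hd (by linarith)
    (by linarith)
  have hright := sinh_mul_sinh_le (s := (e - c) / 2) (t := (e - b) / 2) hd (by linarith)
    (by linarith)
  have hsinh {x y : ℝ} (hx : 0 ≤ x) (hy : 0 ≤ y) : 0 ≤ Real.sinh (d * x) * Real.sinh y :=
    mul_nonneg (Real.sinh_nonneg_iff.2 (by positivity)) (Real.sinh_nonneg_iff.2 hy)
  have hprod := mul_le_mul hleft hright (hsinh (by linarith) (by linarith))
    (hsinh (by linarith) (by linarith))
  simp only [signedPow_exp, exp_sub_exp_mul_exp_sub_exp, hscale]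
  rw [show (a * d + c * d + b * d + e * d) / 2 = (a * d + b * d + c * d + e * d) / 2 by ring,
    show (a + c + b + e) / 2 = (a + b + c + e) / 2 by ring]
  set E := Real.exp ((a * d + b * d + c * d + e * d) / 2)
  set E' := Real.exp ((a + b + c + e) / 2)
  have : 0 ≤ 16 * E * E' := by positivity
  linear_combination (16 * E * E') * hprod

theorem slope_signedPow_mul_slope_le {d a b c e : ℝ} (hd : 1 ≤ d) (hab : a < b) (hbc : b < c)
    (hce : c < e) (h0 : 0 < a ∨ e < 0) :
    slope (signedPow d) a b * slope (signedPow d) c e ≤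
      slope (signedPow d) a c * slope (signedPow d) b e := by
  simp only [slope_def_field]
  rw [div_mul_div_comm, div_mul_div_comm, div_le_div_iff₀
    (mul_pos (sub_pos.2 hab) (sub_pos.2 hce))
    (mul_pos (sub_pos.2 (hab.trans hbc)) (sub_pos.2 (hbc.trans hce)))]
  rcases h0 with h0 | h0
  · exact signedPow_sub_mul_sub_le hd h0 hab hbc hce
  · have := signedPow_sub_mul_sub_le (a := -e) (b := -c) (c := -b) (e := -a) hd
      (neg_pos.2 h0) (neg_lt_neg hce) (neg_lt_neg hbc) (neg_lt_neg hab)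
    simp only [signedPow_neg] at this
    linarith

/-! ### Distortion of power-like maps -/

/-- Bounded distortion: `φ` is increasing on `s`, and on each interval `[w, z] ⊆ s` any two of its
average slopes are comparable up to the factor `exp (K * (z - w))`. -/
structure BoundedDistortionOn (K : ℝ) (φ : ℝ → ℝ) (s : Set ℝ) : Prop where
  strictMonoOn : StrictMonoOn φ s
  slope_le : ∀ ⦃w z u v x y : ℝ⦄, Icc w z ⊆ s → w ≤ u → u < v → v ≤ z → w ≤ x → x < y → y ≤ z →
    slope φ x y ≤ Real.exp (K * (z - w)) * slope φ u v

theorem boundedDistortionOn_of_lipschitzOnWith {φ : ℝ → ℝ} {s : Set ℝ} {K : NNReal}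
    (hs : Convex ℝ s) (hdiff : ∀ x ∈ s, DifferentiableAt ℝ φ x) (hpos : ∀ x ∈ s, 0 < deriv φ x)
    (hlip : LipschitzOnWith K (fun x => Real.log (deriv φ x)) s) :
    BoundedDistortionOn K φ s := by
  have hcont : ContinuousOn φ s := fun x hx => (hdiff x hx).continuousAt.continuousWithinAt
  refine ⟨strictMonoOn_of_deriv_pos hs hcont fun x hx => hpos x (interior_subset hx),
    fun w z u v x y hwz hwu huv hvz hwx hxy hyz => ?_⟩
  have hmean {u v : ℝ} (hwu : w ≤ u) (huv : u < v) (hvz : v ≤ z) :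
      ∃ ξ ∈ Icc w z, slope φ u v = deriv φ ξ := by
    have hsub : Icc u v ⊆ s := (Icc_subset_Icc hwu hvz).trans hwz
    obtain ⟨ξ, hξ, heq⟩ := exists_deriv_eq_slope' φ huv (hcont.mono hsub) fun t ht =>
      (hdiff t (hsub (Ioo_subset_Icc_self ht))).differentiableWithinAt
    exact ⟨ξ, Icc_subset_Icc hwu hvz (Ioo_subset_Icc_self hξ), heq.symm⟩
  obtain ⟨ξ, hξ, hξ_eq⟩ := hmean hwu huv hvz
  obtain ⟨ζ, hζ, hζ_eq⟩ := hmean hwx hxy hyz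
  have hlog : Real.log (deriv φ ζ) ≤ K * (z - w) + Real.log (deriv φ ξ) := by
    have hdist := hlip.dist_le_mul ζ (hwz hζ) ξ (hwz hξ)
    rw [Real.dist_eq, Real.dist_eq] at hdist
    have := mul_le_mul_of_nonneg_left (abs_sub_le_of_le_of_le hζ.1 hζ.2 hξ.1 hξ.2) K.coe_nonneg
    linarith [le_abs_self (Real.log (deriv φ ζ) - Real.log (deriv φ ξ))]
  rw [hξ_eq, hζ_eq, ← Real.exp_log (hpos ξ (hwz hξ)), ← Real.exp_log (hpos ζ (hwz hζ)),
    ← Real.exp_add]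
  exact Real.exp_le_exp.2 hlog

theorem exists_boundedDistortionOn {φ : ℝ → ℝ} {x₀ : ℝ} (hφ : ContDiffAt ℝ 2 φ x₀)
    (hpos : 0 < deriv φ x₀) : ∃ K s, 0 ≤ K ∧ s ∈ 𝓝 x₀ ∧ BoundedDistortionOn K φ s := by
  have hderiv : ContDiffAt ℝ 1 (deriv φ) x₀ :=
    (hφ.fderiv_right (m := 1) (by norm_num)).clm_apply contDiffAt_const
  obtain ⟨K, t, ht, hlip⟩ := (hderiv.log hpos.ne').exists_lipschitzOnWith
  have hdiff : ∀ᶠ x in 𝓝 x₀, DifferentiableAt ℝ φ x :=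
    (hφ.eventually (by simp)).mono fun x hx => hx.differentiableAt (by simp)
  obtain ⟨r, hr, hball⟩ := Metric.eventually_nhds_iff_ball.1
    ((hdiff.and (hderiv.continuousAt.eventually (lt_mem_nhds hpos))).and ht)
  exact ⟨K, Metric.ball x₀ r, K.2, Metric.ball_mem_nhds x₀ hr,
    boundedDistortionOn_of_lipschitzOnWith (convex_ball x₀ r) (fun x hx => (hball x hx).1.1)
      (fun x hx => (hball x hx).1.2) (hlip.mono fun x hx => (hball x hx).2)⟩

theorem slope_eq_slope_mul_slope {P φ F : ℝ → ℝ} {k u v : ℝ} (hu : F u = k + P (φ u))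
    (hv : F v = k + P (φ v)) (huv : φ u ≠ φ v) :
    slope F u v = slope P (φ u) (φ v) * slope φ u v := by
  have : φ v - φ u ≠ 0 := sub_ne_zero.2 huv.symm
  simp only [slope_def_field, hu, hv, add_sub_add_left_eq_sub]
  field_simp

section SignedPowComp

variable {F φ : ℝ → ℝ} {K k d : ℝ} {s : Set ℝ}

theorem slope_le_of_eq_signedPow_comp (hd : 1 ≤ d) (hφ : BoundedDistortionOn K φ s)
    (hF : ∀ x ∈ s, F x = k + signedPow d (φ x)) {u x y v : ℝ} (hs : Icc u v ⊆ s) (hux : u ≤ x)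
    (hxy : x < y) (hyv : y ≤ v) :
    slope F x y ≤ 2 * d * Real.exp (K * (v - u)) * slope F u v := by
  have hu : u ∈ s := hs ⟨le_rfl, by linarith⟩
  have hx : x ∈ s := hs ⟨hux, by linarith⟩
  have hy : y ∈ s := hs ⟨by linarith, hyv⟩
  have hv : v ∈ s := hs ⟨by linarith, le_rfl⟩
  have hφxy := hφ.strictMonoOn hx hy hxy
  have hφuv := hφ.strictMonoOn hu hv (by linarith)
  have hpow := slope_signedPow_le hd (hφ.strictMonoOn.monotoneOn hu hx hux) hφxy
    (hφ.strictMonoOn.monotoneOn hy hv hyv)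
  have hslope := hφ.slope_le hs le_rfl (by linarith) le_rfl hux hxy hyv
  rw [slope_eq_slope_mul_slope (hF x hx) (hF y hy) hφxy.ne,
    slope_eq_slope_mul_slope (hF u hu) (hF v hv) hφuv.ne]
  refine (mul_le_mul hpow hslope (slope_pos_of_strictMonoOn hφ.strictMonoOn hx hy hxy).le
    ((slope_pos_of_strictMono (strictMono_signedPow hd) hφxy).le.trans hpow)).trans_eq ?_
  ring

theorem slope_mul_slope_le_of_eq_signedPow_comp (hd : 1 ≤ d) (hφ : BoundedDistortionOn K φ s)
    (hF : ∀ x ∈ s, F x = k + signedPow d (φ x)) {a b c e : ℝ} (hs : Icc a e ⊆ s) (hab : a < b)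
    (hbc : b < c) (hce : c < e) (h0 : 0 < φ a ∨ φ e < 0) :
    slope F a b * slope F c e ≤ Real.exp (2 * K * (e - a)) * (slope F a c * slope F b e) := by
  have ha : a ∈ s := hs ⟨le_rfl, by linarith⟩
  have hb : b ∈ s := hs ⟨hab.le, by linarith⟩
  have hc : c ∈ s := hs ⟨by linarith, hce.le⟩
  have he : e ∈ s := hs ⟨by linarith, le_rfl⟩
  have hφab := hφ.strictMonoOn ha hb hab
  have hφbc := hφ.strictMonoOn hb hc hbc
  have hφce := hφ.strictMonoOn hc he hce
  have hpow := slope_signedPow_mul_slope_le hd hφab hφbc hφce h0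
  have hleft := hφ.slope_le hs le_rfl (hab.trans hbc) hce.le le_rfl hab (by linarith)
  have hright := hφ.slope_le hs hab.le (hbc.trans hce) le_rfl (by linarith) hce le_rfl
  have hφpos {x y : ℝ} (hx : x ∈ s) (hy : y ∈ s) (hxy : x < y) : 0 < slope φ x y :=
    slope_pos_of_strictMonoOn hφ.strictMonoOn hx hy hxy
  have hPpos {x y : ℝ} (hxy : x < y) : 0 < slope (signedPow d) x y :=
    slope_pos_of_strictMono (strictMono_signedPow hd) hxy
  have hprod := mul_le_mul hpow (mul_le_mul hleft hright (hφpos hc he hce).le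
    ((hφpos ha hb hab).le.trans hleft)) (mul_pos (hφpos ha hb hab) (hφpos hc he hce)).le
    (mul_pos (hPpos (hφab.trans hφbc)) (hPpos (hφbc.trans hφce))).le
  rw [slope_eq_slope_mul_slope (hF a ha) (hF b hb) hφab.ne,
    slope_eq_slope_mul_slope (hF c hc) (hF e he) hφce.ne,
    slope_eq_slope_mul_slope (hF a ha) (hF c hc) (hφab.trans hφbc).ne,
    slope_eq_slope_mul_slope (hF b hb) (hF e he) (hφbc.trans hφce).ne,
    show 2 * K * (e - a) = K * (e - a) + K * (e - a) by ring, Real.exp_add]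
  linarith

end SignedPowComp

/-- Near `x₀` the map `F` is a power map of exponent `d` up to a `C^2` change of coordinates in the
domain. The exponent `d = 1` is allowed and describes the points with positive derivative, so that
regular and critical points are treated alike. -/
def IsPowerLikeAt (F : ℝ → ℝ) (x₀ d : ℝ) : Prop :=
  1 ≤ d ∧ ∃ φ : ℝ → ℝ, ContDiffAt ℝ 2 φ x₀ ∧ φ x₀ = 0 ∧ 0 < deriv φ x₀ ∧
    ∀ᶠ x in 𝓝 x₀, F x = F x₀ + signedPow d (φ x)

/-- Distortion control for `F` on the intervals `[u, v]` with `v ≤ u + 1 / M`: the average slope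
on `[u, v]` dominates those on its subintervals, and cross-ratios are distorted by at most
`exp (M * (v - u))` when no translate of a point of `S` lies in the interval. A single constant `M`
serves as bound and as inverse scale, so that the condition weakens as `M` grows. -/
structure DistortionAt (F : ℝ → ℝ) (M : ℝ) (S : Finset ℝ) (u : ℝ) : Prop where
  slope_le : ∀ ⦃x y v : ℝ⦄, u ≤ x → x < y → y ≤ v → v ≤ u + 1 / M →
    slope F x y ≤ M * slope F u v
  slope_mul_slope_le : ∀ ⦃b c e : ℝ⦄, u < b → b < c → c < e → e ≤ u + 1 / M →
    (∀ y ∈ S, ∀ p : ℤ, y + p ∉ Icc u e) →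
      slope F u b * slope F c e ≤ Real.exp (M * (e - u)) * (slope F u c * slope F b e)

theorem DistortionAt.mono {F : ℝ → ℝ} {M u : ℝ} {S T : Finset ℝ} (h : DistortionAt F M S u)
    (hST : S ⊆ T) : DistortionAt F M T u :=
  ⟨h.slope_le, fun _ _ _ hub hbc hce he hT =>
    h.slope_mul_slope_le hub hbc hce he fun y hy => hT y (hST hy)⟩

theorem IsPowerLikeAt.exists_distortionAt {F : ℝ → ℝ} (hF : StrictMono F) {x₀ d : ℝ}
    (h : IsPowerLikeAt F x₀ d) :
    ∃ t ∈ 𝓝 x₀, ∀ᶠ M in atTop, ∀ u ∈ t, DistortionAt F M {x₀} u := by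
  obtain ⟨hd, φ, hφ, hφ₀, hpos, heq⟩ := h
  obtain ⟨K, s, hK, hs, hdist⟩ := exists_boundedDistortionOn hφ hpos
  obtain ⟨r, hr, hball⟩ := Metric.eventually_nhds_iff_ball.1 (heq.and hs)
  rw [Real.ball_eq_Ioo] at hball
  have hdist : BoundedDistortionOn K φ (Ioo (x₀ - r) (x₀ + r)) :=
    ⟨hdist.strictMonoOn.mono fun x hx => (hball x hx).2, fun w z u v x y hwz =>
      hdist.slope_le fun x hx => (hball x (hwz hx)).2⟩
  have hx₀ : x₀ ∈ Ioo (x₀ - r) (x₀ + r) := ⟨by linarith, by linarith⟩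
  refine ⟨Ioo (x₀ - r / 2) (x₀ + r / 2), Ioo_mem_nhds (by linarith) (by linarith), ?_⟩
  filter_upwards [eventually_ge_atTop (2 * d * Real.exp (K * (r / 2))),
    eventually_ge_atTop (2 * K), eventually_ge_atTop (2 / r)] with M hM hMK hMr u hu
  have hMr : 1 / M ≤ r / 2 := by
    simpa using one_div_le_one_div_of_le (by positivity) hMr
  have hsub {v : ℝ} (hv : v ≤ u + 1 / M) : Icc u v ⊆ Ioo (x₀ - r) (x₀ + r) := fun x hx =>
    ⟨by linarith [hu.1, hx.1], by linarith [hu.2, hx.2]⟩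
  have heq (x : ℝ) (hx : x ∈ Ioo (x₀ - r) (x₀ + r)) := (hball x hx).1
  constructor
  · intro x y v hux hxy hyv hv
    refine (slope_le_of_eq_signedPow_comp hd hdist heq (hsub hv) hux hxy hyv).trans ?_
    have := slope_pos_of_strictMono hF (show u < v by linarith)
    gcongr
    refine le_trans ?_ hM
    gcongr
    linarith
  · intro b c e hub hbc hce he hS
    have hx₀_notMem : x₀ ∉ Icc u e := by simpa using hS x₀ (Finset.mem_singleton_self x₀) 0
    have h0 : 0 < φ u ∨ φ e < 0 := by
      rw [← hφ₀]
      rcases lt_or_ge x₀ u with hxu | hux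
      · exact Or.inl (hdist.strictMonoOn hx₀ (hsub he ⟨le_rfl, by linarith⟩) hxu)
      · exact Or.inr (hdist.strictMonoOn (hsub he ⟨by linarith, le_rfl⟩) hx₀
          (not_le.1 fun hxe => hx₀_notMem ⟨hux, hxe⟩))
    refine (slope_mul_slope_le_of_eq_signedPow_comp hd hdist heq (hsub he) hub hbc hce h0).trans ?_
    have := slope_pos_of_strictMono hF (hub.trans hbc)
    have := slope_pos_of_strictMono hF (hbc.trans hce)
    have : 0 ≤ e - u := by linarith
    gcongr

theorem exists_distortionAt_of_isCompact {F : ℝ → ℝ} (hF : StrictMono F) {s : Set ℝ}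
    (hs : IsCompact s) (h : ∀ x ∈ s, ∃ d, IsPowerLikeAt F x d) :
    ∃ S : Finset ℝ, ∀ᶠ M in atTop, ∀ u ∈ s, DistortionAt F M S u := by
  classical
  refine hs.induction_on (p := fun s => ∃ S : Finset ℝ, ∀ᶠ M in atTop, ∀ u ∈ s,
    DistortionAt F M S u) ⟨∅, by simp⟩ ?_ ?_ ?_
  · rintro s t hst ⟨S, hS⟩
    exact ⟨S, hS.mono fun M hM u hu => hM u (hst hu)⟩
  · rintro s t ⟨S, hS⟩ ⟨T, hT⟩
    refine ⟨S ∪ T, (hS.and hT).mono fun M hM u hu => ?_⟩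
    rcases hu with hu | hu
    · exact (hM.1 u hu).mono Finset.subset_union_left
    · exact (hM.2 u hu).mono Finset.subset_union_right
  · intro x hx
    obtain ⟨d, hd⟩ := h x hx
    obtain ⟨t, ht, hM⟩ := hd.exists_distortionAt hF
    exact ⟨t, mem_nhdsWithin_of_mem_nhds ht, {x}, hM⟩

theorem slope_sub_int (F : CircleDeg1Lift) (x y : ℝ) (m : ℤ) :
    slope F (x - m) (y - m) = slope F x y := by
  simp only [slope_def_field, CircleDeg1Lift.map_sub_int, sub_sub_sub_cancel_right]

theorem DistortionAt.of_sub_int {F : CircleDeg1Lift} {M u : ℝ} {S : Finset ℝ} (m : ℤ)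
    (h : DistortionAt F M S (u - m)) : DistortionAt F M S u := by
  constructor
  · intro x y v hux hxy hyv hv
    have := h.slope_le (x := x - m) (y := y - m) (v := v - m) (by linarith) (by linarith)
      (by linarith) (by linarith)
    rwa [slope_sub_int, slope_sub_int] at this
  · intro b c e hub hbc hce he hS
    have := h.slope_mul_slope_le (b := b - m) (c := c - m) (e := e - m) (by linarith) (by linarith)
      (by linarith) (by linarith) fun y hy p hp => hS y hy (p + m)
        ⟨by push_cast; linarith [hp.1], by push_cast; linarith [hp.2]⟩
    rwa [slope_sub_int, slope_sub_int, slope_sub_int, slope_sub_int,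
      sub_sub_sub_cancel_right] at this

theorem exists_distortionAt {F : CircleDeg1Lift} (hF : StrictMono F)
    (h : ∀ x, ∃ d, IsPowerLikeAt F x d) :
    ∃ S : Finset ℝ, ∀ᶠ M in atTop, ∀ u, DistortionAt F M S u := by
  obtain ⟨S, hS⟩ := exists_distortionAt_of_isCompact hF (isCompact_Icc (a := (0 : ℝ)) (b := 1))
    fun x _ => h x
  refine ⟨S, hS.mono fun M hM u => .of_sub_int ⌊u⌋ (hM _ ?_)⟩
  exact ⟨Int.fract_nonneg u, (Int.fract_lt_one u).le⟩

theorem exists_pos_le_sub {F : CircleDeg1Lift} (hF : StrictMono F) (hcont : Continuous F) {η : ℝ}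
    (hη : 0 < η) : ∃ μ : ℝ, 0 < μ ∧ ∀ u, μ ≤ F (u + η) - F u := by
  obtain ⟨z, -, hz⟩ := isCompact_Icc.exists_isMinOn (s := Icc (0 : ℝ) 1)
    (nonempty_Icc.2 zero_le_one) (f := fun u => F (u + η) - F u) (by fun_prop)
  refine ⟨F (z + η) - F z, sub_pos.2 (hF (by linarith)), fun u => ?_⟩
  have hmin : F (z + η) - F z ≤ F (Int.fract u + η) - F (Int.fract u) :=
    hz ⟨Int.fract_nonneg u, (Int.fract_lt_one u).le⟩
  rwa [Int.fract, sub_add_eq_add_sub, F.map_sub_int, F.map_sub_int,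
    sub_sub_sub_cancel_right] at hmin

theorem map_sub_map_le_one (F : CircleDeg1Lift) {x y : ℝ} (h : y ≤ x + 1) : F y - F x ≤ 1 := by
  linarith [F.monotone h, F.map_add_one x]

theorem slope_le_sq_of_distortionAt {F : CircleDeg1Lift} {M : ℝ} {S : Finset ℝ} (hM : 1 ≤ M)
    {x y : ℝ} (h : DistortionAt F M S x) (hxy : x < y) (hyx : y ≤ x + 1) :
    slope F x y ≤ M ^ 2 := by
  have hpos : 0 < 1 / M := by positivity
  rcases le_or_gt y (x + 1 / M) with hy | hy
  · have hscale : slope F x (x + 1 / M) ≤ M := by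
      rw [slope_def_field, add_sub_cancel_left, div_div_eq_mul_div, div_one]
      have : 1 / M ≤ 1 := by simpa using inv_le_one_of_one_le₀ hM
      nlinarith [map_sub_map_le_one F (show x + 1 / M ≤ x + 1 by linarith)]
    calc slope F x y ≤ M * slope F x (x + 1 / M) := h.slope_le le_rfl hxy hy le_rfl
      _ ≤ M * M := by gcongr
      _ = M ^ 2 := by ring
  · rw [slope_def_field, div_le_iff₀ (by linarith)]
    have : 1 ≤ M * (y - x) := by
      rw [← div_le_iff₀' (by linarith)]
      linarith
    nlinarith [map_sub_map_le_one F hyx]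

/-- At small scales this is part of `DistortionAt`; at larger scales all slopes are bounded from
above and from below. -/
theorem exists_slope_le_of_distortionAt {F : CircleDeg1Lift} (hF : StrictMono F)
    (hcont : Continuous F) {M : ℝ} {S : Finset ℝ} (hM : 1 ≤ M) (h : ∀ u, DistortionAt F M S u) :
    ∃ D : ℝ, 0 < D ∧ ∀ u x y v : ℝ, u ≤ x → x < y → y ≤ v → v ≤ u + 1 →
      slope F x y ≤ D * slope F u v := by
  obtain ⟨μ, hμ, hμ_le⟩ := exists_pos_le_sub hF hcont (show 0 < 1 / M by positivity)
  refine ⟨max M (M ^ 2 / μ), by positivity, fun u x y v hux hxy hyv hvu => ?_⟩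
  have huv : u < v := by linarith
  have := slope_pos_of_strictMono hF huv
  rcases le_or_gt v (u + 1 / M) with hv | hv
  · refine ((h u).slope_le hux hxy hyv hv).trans ?_
    gcongr
    exact le_max_left _ _
  · have hlower : μ ≤ slope F u v := by
      rw [slope_def_field, le_div_iff₀ (by linarith)]
      nlinarith [hμ_le u, F.monotone hv.le]
    calc slope F x y ≤ M ^ 2 := slope_le_sq_of_distortionAt hM (h x) hxy (by linarith)
      _ = M ^ 2 / μ * μ := by field_simp
      _ ≤ max M (M ^ 2 / μ) * slope F u v := by
        gcongr
        exact le_max_right _ _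

/-! ### Cross-ratios -/

/-- The cross-ratio `(b - a) (e - c) / ((c - a) (e - b))` of four points `a < b < c < e` of the
line. -/
noncomputable def crossRatio (a b c e : ℝ) : ℝ := (b - a) * (e - c) / ((c - a) * (e - b))

theorem crossRatio_pos {a b c e : ℝ} (hab : a < b) (hbc : b < c) (hce : c < e) :
    0 < crossRatio a b c e := by
  rw [crossRatio]
  exact div_pos (mul_pos (by linarith) (by linarith)) (mul_pos (by linarith) (by linarith))

theorem crossRatio_map_le {F : ℝ → ℝ} (hF : StrictMono F) {a b c e M : ℝ} (hab : a < b)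
    (hbc : b < c) (hce : c < e)
    (h : slope F a b * slope F c e ≤ M * (slope F a c * slope F b e)) :
    crossRatio (F a) (F b) (F c) (F e) ≤ M * crossRatio a b c e := by
  have hac := hab.trans hbc
  have hbe := hbc.trans hce
  have hpos : 0 < slope F a c * slope F b e :=
    mul_pos (slope_pos_of_strictMono hF hac) (slope_pos_of_strictMono hF hbe)
  have heq : crossRatio (F a) (F b) (F c) (F e) =
      slope F a b * slope F c e / (slope F a c * slope F b e) * crossRatio a b c e := by
    have := sub_pos.2 hab
    have := sub_pos.2 hce
    have := sub_pos.2 hac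
    have := sub_pos.2 hbe
    have := sub_pos.2 (hF hac)
    have := sub_pos.2 (hF hbe)
    simp only [crossRatio, slope_def_field]
    field_simp
  rw [heq]
  exact mul_le_mul_of_nonneg_right ((div_le_iff₀ hpos).2 h) (crossRatio_pos hab hbc hce).le

/-- The interval `[a, e]` is exceptional for the scale `1 / M` and the set `S` if it is longer than
`1 / M` or contains a translate of a point of `S`. -/
def IsExceptional (M : ℝ) (S : Finset ℝ) (a e : ℝ) : Prop :=
  1 / M < e - a ∨ ∃ y ∈ S, ∃ p : ℤ, y + p ∈ Icc a e

/-- The distortion of cross-ratios under `F` is bounded by `M` on intervals of length at most one,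
and by `exp (M * (e - a))` on intervals `[a, e]` which are not exceptional. -/
structure CrossRatioBounds (F : ℝ → ℝ) (M : ℝ) (S : Finset ℝ) : Prop where
  le_mul : ∀ ⦃a b c e : ℝ⦄, a < b → b < c → c < e → e ≤ a + 1 →
    crossRatio (F a) (F b) (F c) (F e) ≤ M * crossRatio a b c e
  le_exp_mul : ∀ ⦃a b c e : ℝ⦄, a < b → b < c → c < e → ¬IsExceptional M S a e →
    crossRatio (F a) (F b) (F c) (F e) ≤ Real.exp (M * (e - a)) * crossRatio a b c e

theorem exists_crossRatioBounds {F : CircleDeg1Lift} (hF : StrictMono F) (hcont : Continuous F)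
    (h : ∀ x, ∃ d, IsPowerLikeAt F x d) : ∃ M S, 1 ≤ M ∧ CrossRatioBounds F M S := by
  obtain ⟨S, hS⟩ := exists_distortionAt hF h
  obtain ⟨M₀, hM₀, hM₀_one⟩ := (hS.and (eventually_ge_atTop 1)).exists
  obtain ⟨D, hD, hslope⟩ := exists_slope_le_of_distortionAt hF hcont hM₀_one hM₀
  obtain ⟨M, hM, hM_one, hMD⟩ :=
    (hS.and ((eventually_ge_atTop 1).and (eventually_ge_atTop (D * D)))).exists
  refine ⟨M, S, hM_one, fun a b c e hab hbc hce hea => ?_, fun a b c e hab hbc hce hexc => ?_⟩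
  swap
  · simp only [IsExceptional, not_or, not_exists, not_and, not_lt] at hexc
    exact crossRatio_map_le hF hab hbc hce
      ((hM a).slope_mul_slope_le hab hbc hce (by linarith [hexc.1]) hexc.2)
  apply crossRatio_map_le hF hab hbc hce
  have hleft := hslope a a b c le_rfl hab hbc.le (by linarith)
  have hright := hslope b c e e hbc.le hce le_rfl (by linarith)
  have hpos {x y : ℝ} (hxy : x < y) := slope_pos_of_strictMono hF hxy
  have := hpos (hab.trans hbc)
  have := hpos (hbc.trans hce)
  have := hpos hce
  calc slope F a b * slope F c e ≤ (D * slope F a c) * (D * slope F b e) := by gcongr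
    _ = D * D * (slope F a c * slope F b e) := by ring
    _ ≤ M * (slope F a c * slope F b e) := by gcongr

/-! ### The cross-ratio inequality for iterates -/

theorem intervalIntegrable_floor_sub (t : ℝ) :
    IntervalIntegrable (fun y => (⌊t - y⌋ : ℝ)) MeasureTheory.volume 0 1 := by
  refine Antitone.intervalIntegrable fun x y hxy => ?_
  exact Int.cast_le.2 (Int.floor_mono (sub_le_sub_left hxy t))

theorem integral_floor_sub (t : ℝ) : ∫ y in (0 : ℝ)..1, (⌊t - y⌋ : ℝ) = t - 1 := by
  have hfract : ∫ y in (0 : ℝ)..1, Int.fract (t - y) = 1 / 2 := by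
    have hper : Function.Periodic (Int.fract : ℝ → ℝ) 1 := Int.fract_add_one
    rw [intervalIntegral.integral_comp_sub_left (fun y => Int.fract y) t]
    have hshift := hper.intervalIntegral_add_eq (t - 1) 0
    rw [sub_add_cancel, zero_add] at hshift
    rw [sub_zero, hshift, intervalIntegral.integral_congr_Ioo_of_le zero_le_one
      (f := Int.fract) (g := id) fun y hy => Int.fract_eq_self.2 ⟨hy.1.le, hy.2⟩]
    simp
  have hlin : IntervalIntegrable (fun y : ℝ => t - y) MeasureTheory.volume 0 1 :=
    (continuous_const.sub continuous_id).intervalIntegrable _ _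
  simp only [Int.fract] at hfract
  rw [intervalIntegral.integral_sub hlin (intervalIntegrable_floor_sub t)] at hfract
  have : ∫ y in (0 : ℝ)..1, (t - y) = t - 1 / 2 := by
    rw [intervalIntegral.integral_sub (by simp) (by simp)]
    simp
  linarith

open Classical in
theorem floor_sub_sub_floor_sub_le {a e : ℝ} (hae : e < a + 1) (y : ℝ) :
    ⌊e - y⌋ - ⌊a - y⌋ ≤ if ∃ p : ℤ, y + p ∈ Icc a e then 1 else 0 := by
  split_ifs with h
  · have : ⌊e - y⌋ ≤ ⌊a - y + 1⌋ := Int.floor_mono (by linarith)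
    rw [Int.floor_add_one] at this
    linarith
  · by_contra! hlt
    refine h ⟨⌊e - y⌋, ?_, by linarith [Int.floor_le (e - y)]⟩
    have := Int.floor_lt.1 (sub_pos.1 hlt)
    linarith

open Classical in
/-- The integral over `y ∈ [0, 1]` of `⌊e - y⌋ - ⌊a - y⌋`, which is at most the number of
translates of `y` in `[a, e]`, is the length `e - a`. -/
theorem sum_length_le_of_multiplicity_le {ι : Type*} (s : Finset ι) (a e : ι → ℝ) {m : ℝ}
    (hae : ∀ i ∈ s, e i < a i + 1)
    (hm : ∀ y : ℝ, ((s.filter fun i => ∃ p : ℤ, y + p ∈ Icc (a i) (e i)).card : ℝ) ≤ m) :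
    ∑ i ∈ s, (e i - a i) ≤ m := by
  have hint (i : ι) : IntervalIntegrable (fun y => (⌊e i - y⌋ : ℝ) - ⌊a i - y⌋)
      MeasureTheory.volume 0 1 :=
    (intervalIntegrable_floor_sub _).sub (intervalIntegrable_floor_sub _)
  calc ∑ i ∈ s, (e i - a i)
      = ∫ y in (0 : ℝ)..1, ∑ i ∈ s, ((⌊e i - y⌋ : ℝ) - ⌊a i - y⌋) := by
        rw [intervalIntegral.integral_finsetSum fun i _ => hint i]
        refine Finset.sum_congr rfl fun i _ => ?_
        rw [intervalIntegral.integral_sub (intervalIntegrable_floor_sub _)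
          (intervalIntegrable_floor_sub _), integral_floor_sub, integral_floor_sub]
        ring
    _ ≤ ∫ _ in (0 : ℝ)..1, m := by
        refine intervalIntegral.integral_mono_on zero_le_one ?_ (by simp) fun y _ => ?_
        · simpa only [Finset.sum_fn] using IntervalIntegrable.sum s fun i _ => hint i
        · refine le_trans ?_ (hm y)
          rw [Finset.card_filter]
          push_cast
          exact Finset.sum_le_sum fun i hi =>
            mod_cast floor_sub_sub_floor_sub_le (hae i hi) y
    _ = m := by simp

theorem iterate_lt_iterate_add_one {F : CircleDeg1Lift} (hF : StrictMono F) {a e : ℝ}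
    (h : e < a + 1) (k : ℕ) : F^[k] e < F^[k] a + 1 := by
  have := hF.iterate k h
  rwa [← CircleDeg1Lift.coe_pow, CircleDeg1Lift.map_add_one, CircleDeg1Lift.coe_pow] at this

theorem map_iterate_of_map_eq_add {F h : CircleDeg1Lift} {α : ℝ}
    (hsemi : ∀ x, h (F x) = h x + α) (i : ℕ) (x : ℝ) : h (F^[i] x) = h x + i * α := by
  induction i with
  | zero => simp
  | succ i ih =>
    rw [Function.iterate_succ_apply', hsemi, ih]
    push_cast
    ring

open Classical in
/-- If two iterates cover `y` modulo one, then the rotation `h` is semiconjugate to brings two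
points of an orbit within `L / N`; these are `c₀ / N`-separated. -/
theorem card_iterate_cover_le {F h : CircleDeg1Lift} {α c₀ L : ℝ}
    (hsemi : ∀ x, h (F x) = h x + α) (hc₀ : 0 < c₀) (hbad : BadlyApproximableWith c₀ α)
    {N k : ℕ} (hN : 1 ≤ N) (hk : k ≤ N) {a e : ℝ} (hae : a ≤ e) (hL : h e - h a ≤ L / N) (y : ℝ) :
    (((Finset.range k).filter fun i => ∃ p : ℤ, y + p ∈ Icc (F^[i] a) (F^[i] e)).card : ℝ) ≤
      L / c₀ + 1 := by
  have : (0 : ℝ) < N := by exact_mod_cast hN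
  choose! p hp using fun (i : ℕ) (hi : ∃ p : ℤ, y + p ∈ Icc (F^[i] a) (F^[i] e)) => hi
  refine (card_le_of_separated _ (fun i => i * α - p i) (η := c₀ / N) (u := h y - h e)
    (l := h e - h a) (by positivity) (sub_nonneg.2 (h.monotone hae)) (fun i hi => ?_)
    fun i hi j hj hij => ?_).trans ?_
  · obtain ⟨hleft, hright⟩ := hp i (Finset.mem_filter.1 hi).2
    have hleft := h.monotone hleft
    have hright := h.monotone hright
    rw [map_iterate_of_map_eq_add hsemi, h.map_add_int] at hleft hright
    constructor <;> linarith
  · rw [Finset.mem_filter, Finset.mem_range] at hi hj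
    exact hbad.le_abs_sub hc₀.le (by omega) (by omega) hij _ _
  · rw [show L / c₀ = L / N / (c₀ / N) by field_simp]
    gcongr

open Classical in
theorem crossRatio_iterate_le_pow_mul {F : CircleDeg1Lift} {M : ℝ} {S : Finset ℝ}
    (hF : StrictMono F) (hM : 1 ≤ M) (hB : CrossRatioBounds F M S) {a b c e : ℝ} (hab : a < b)
    (hbc : b < c) (hce : c < e) (hea : e < a + 1) (k : ℕ) :
    crossRatio (F^[k] a) (F^[k] b) (F^[k] c) (F^[k] e) ≤
      M ^ ((Finset.range k).filter fun i => IsExceptional M S (F^[i] a) (F^[i] e)).card *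
        Real.exp (M * ∑ i ∈ Finset.range k, (F^[i] e - F^[i] a)) * crossRatio a b c e := by
  induction k with
  | zero => simp
  | succ k ih =>
    have hFk := hF.iterate k
    have hpos := crossRatio_pos (hFk hab) (hFk hbc) (hFk hce)
    have hlen : 0 ≤ F^[k] e - F^[k] a := (sub_pos.2 (hFk (hab.trans (hbc.trans hce)))).le
    have hstep : crossRatio (F (F^[k] a)) (F (F^[k] b)) (F (F^[k] c)) (F (F^[k] e)) ≤
        M ^ (if IsExceptional M S (F^[k] a) (F^[k] e) then 1 else 0) *
          Real.exp (M * (F^[k] e - F^[k] a)) *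
            crossRatio (F^[k] a) (F^[k] b) (F^[k] c) (F^[k] e) := by
      split_ifs with hexc
      · refine (hB.le_mul (hFk hab) (hFk hbc) (hFk hce)
          (iterate_lt_iterate_add_one hF hea k).le).trans ?_
        have : 1 ≤ Real.exp (M * (F^[k] e - F^[k] a)) := Real.one_le_exp (by positivity)
        gcongr
        rw [pow_one]
        exact le_mul_of_one_le_right (by positivity) this
      · simpa using hB.le_exp_mul (hFk hab) (hFk hbc) (hFk hce) hexc
    simp only [Function.iterate_succ_apply']
    refine (hstep.trans (mul_le_mul_of_nonneg_left ih (by positivity))).trans_eq ?_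
    rw [Finset.card_filter, Finset.card_filter, Finset.sum_range_succ, Finset.sum_range_succ,
      pow_add, mul_add, Real.exp_add]
    ring

open Classical in
theorem card_isExceptional_le {ι : Type*} {s : Finset ι} {a e : ι → ℝ} {M m : ℝ} {S : Finset ℝ}
    (hM : 0 < M) (hae : ∀ i ∈ s, a i ≤ e i) (hsum : ∑ i ∈ s, (e i - a i) ≤ m)
    (hm : ∀ y : ℝ, ((s.filter fun i => ∃ p : ℤ, y + p ∈ Icc (a i) (e i)).card : ℝ) ≤ m) :
    ((s.filter fun i => IsExceptional M S (a i) (e i)).card : ℝ) ≤ M * m + S.card * m := by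
  have hlong : ((s.filter fun i => 1 / M < e i - a i).card : ℝ) ≤ M * m := by
    rw [← div_le_iff₀' hM, div_eq_mul_one_div, ← nsmul_eq_mul]
    calc _ ≤ ∑ i ∈ s.filter fun i => 1 / M < e i - a i, (e i - a i) :=
          Finset.card_nsmul_le_sum _ _ _ fun i hi => (Finset.mem_filter.1 hi).2.le
      _ ≤ ∑ i ∈ s, (e i - a i) := Finset.sum_le_sum_of_subset_of_nonneg
          (Finset.filter_subset _ _) fun i hi _ => sub_nonneg.2 (hae i hi)
      _ ≤ m := hsum
  have hcentre : ((S.biUnion fun y => s.filter fun i =>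
      ∃ p : ℤ, y + p ∈ Icc (a i) (e i)).card : ℝ) ≤ S.card * m := by
    refine (Nat.cast_le.2 Finset.card_biUnion_le).trans ?_
    rw [Nat.cast_sum, ← nsmul_eq_mul]
    exact Finset.sum_le_card_nsmul _ _ _ fun y _ => hm y
  have hsub : (s.filter fun i => IsExceptional M S (a i) (e i)) ⊆
      (s.filter fun i => 1 / M < e i - a i) ∪
        S.biUnion fun y => s.filter fun i => ∃ p : ℤ, y + p ∈ Icc (a i) (e i) := by
    intro i hi
    simp only [Finset.mem_union, Finset.mem_biUnion, Finset.mem_filter]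
    obtain ⟨hi, hlt | ⟨y, hy, hp⟩⟩ := Finset.mem_filter.1 hi
    · exact Or.inl ⟨hi, hlt⟩
    · exact Or.inr ⟨y, hy, hi, hp⟩
  have hcard := (Finset.card_le_card hsub).trans (Finset.card_union_le _ _)
  refine (Nat.cast_le (α := ℝ).2 hcard).trans ?_
  push_cast
  exact add_le_add hlong hcentre

theorem exists_crossRatio_iterate_le {F h : CircleDeg1Lift} {α c₀ M : ℝ} {S : Finset ℝ}
    (hF : StrictMono F) (hsemi : ∀ x, h (F x) = h x + α) (hc₀ : 0 < c₀)
    (hbad : BadlyApproximableWith c₀ α) (hM : 1 ≤ M) (hB : CrossRatioBounds F M S) (L : ℝ) :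
    ∃ B : ℝ, 1 ≤ B ∧ ∀ N : ℕ, 1 ≤ N → ∀ a b c e : ℝ, a < b → b < c → c < e →
      h e - h a ≤ L / N → h e - h a < 1 → ∀ k ≤ N,
      crossRatio (F^[k] a) (F^[k] b) (F^[k] c) (F^[k] e) ≤ B * crossRatio a b c e := by
  classical
  set m := max (L / c₀ + 1) 0
  obtain ⟨n, hn⟩ := exists_nat_ge (M * m + S.card * m)
  have : 0 ≤ m := le_max_right _ _
  refine ⟨M ^ n * Real.exp (M * m), one_le_mul_of_one_le_of_one_le (one_le_pow₀ hM)
    (Real.one_le_exp (by positivity)), fun N hN a b c e hab hbc hce hL hlt k hk => ?_⟩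
  have hae : a < e := hab.trans (hbc.trans hce)
  have hea : e < a + 1 := by
    by_contra! hcon
    have := h.monotone hcon
    rw [h.map_add_one] at this
    linarith
  have hmult (y : ℝ) : (((Finset.range k).filter
      fun i => ∃ p : ℤ, y + p ∈ Icc (F^[i] a) (F^[i] e)).card : ℝ) ≤ m :=
    (card_iterate_cover_le hsemi hc₀ hbad hN hk hae.le hL y).trans (le_max_left _ _)
  have hsum : ∑ i ∈ Finset.range k, (F^[i] e - F^[i] a) ≤ m :=
    sum_length_le_of_multiplicity_le _ (fun i => F^[i] a) (fun i => F^[i] e)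
      (fun i _ => iterate_lt_iterate_add_one hF hea i) hmult
  have hcard : ((Finset.range k).filter fun i => IsExceptional M S (F^[i] a) (F^[i] e)).card ≤ n :=
    Nat.cast_le.1 ((card_isExceptional_le (by linarith)
      (fun i _ => (hF.iterate i).monotone hae.le) hsum hmult).trans hn)
  have := crossRatio_pos hab hbc hce
  refine (crossRatio_iterate_le_pow_mul hF hM hB hab hbc hce hea k).trans ?_
  gcongr

/-! ### Comparable displacements -/

theorem crossRatio_sub (a b c e p : ℝ) :
    crossRatio (a - p) (b - p) (c - p) (e - p) = crossRatio a b c e := by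
  simp only [crossRatio, sub_sub_sub_cancel_right]

theorem crossRatio_eq_mul (a b c e : ℝ) :
    crossRatio a b c e = (b - a) / (c - a) * ((e - c) / (e - b)) := by
  rw [crossRatio, div_mul_div_comm]

theorem mul_le_of_le_crossRatio {a b c e κ : ℝ} (hab : a < b) (hbc : b < c) (hce : c < e)
    (h : κ ≤ crossRatio a b c e) : κ * (c - a) ≤ b - a ∧ κ * (e - b) ≤ e - c := by
  rw [crossRatio_eq_mul] at h
  have hleft_le : (b - a) / (c - a) ≤ 1 := (div_le_one (by linarith)).2 (by linarith)
  have hright_le : (e - c) / (e - b) ≤ 1 := (div_le_one (by linarith)).2 (by linarith)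
  have hleft_nonneg : 0 ≤ (b - a) / (c - a) := div_nonneg (by linarith) (by linarith)
  have hright_nonneg : 0 ≤ (e - c) / (e - b) := div_nonneg (by linarith) (by linarith)
  rw [← le_div_iff₀ (by linarith), ← le_div_iff₀ (by linarith)]
  exact ⟨h.trans (mul_le_of_le_one_right hleft_nonneg hright_le),
    h.trans (mul_le_of_le_one_left hright_nonneg hleft_le)⟩

theorem le_crossRatio {a b c e δ M : ℝ} (hM : 0 ≤ M) (hab : a < b) (hbc : b < c) (hce : c < e)
    (hleft : δ ≤ b - a) (hright : δ ≤ e - c) (hmid : c - b ≤ M * δ) :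
    (1 / (1 + M)) ^ 2 ≤ crossRatio a b c e := by
  have hle_left : 1 / (1 + M) ≤ (b - a) / (c - a) := by
    rw [div_le_div_iff₀ (by linarith) (by linarith)]
    nlinarith
  have hle_right : 1 / (1 + M) ≤ (e - c) / (e - b) := by
    rw [div_le_div_iff₀ (by linarith) (by linarith)]
    nlinarith
  rw [crossRatio_eq_mul, sq]
  exact mul_le_mul hle_left hle_right (by positivity) (div_nonneg (by linarith) (by linarith))

/-- The cross-ratio of the first four points of the orbit of `x` under `G`. -/
noncomputable def orbitCrossRatio (G : ℝ → ℝ) (x : ℝ) : ℝ :=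
  crossRatio x (G x) (G (G x)) (G (G (G x)))

theorem sub_le_mul_of_orbitCrossRatio_le {G : ℝ → ℝ} {B w : ℝ} (hB : 0 < B)
    (hlt : ∀ x, x < G x) (hmin : ∀ x, G (G (G w)) - G (G w) ≤ G x - x)
    (hcr : orbitCrossRatio G (G w) ≤ B * orbitCrossRatio G w) :
    G (G w) - G w ≤ 4 * B * (G (G (G w)) - G (G w)) := by
  have hlower : (1 / (1 + 1) : ℝ) ^ 2 ≤ orbitCrossRatio G (G w) :=
    le_crossRatio zero_le_one (hlt _) (hlt _) (hlt _) (hmin _) (hmin _) (one_mul _).ge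
  have hquarter : 1 / (4 * B) ≤ orbitCrossRatio G w := by
    rw [div_le_iff₀ (by positivity)]
    norm_num at hlower
    linarith
  have := (mul_le_of_le_crossRatio (hlt _) (hlt _) (hlt _) hquarter).2
  rw [div_mul_eq_mul_div, one_mul, div_le_iff₀ (by positivity)] at this
  linarith [hlt (G (G w))]

theorem le_orbitCrossRatio_of_mem_Ioo {G : ℝ → ℝ} {B z w : ℝ} (hB : 1 ≤ B) (hG : StrictMono G)
    (hlt : ∀ x, x < G x) (hmin : ∀ x, G (G z) - G z ≤ G x - x)
    (hz : G z - z ≤ 4 * B * (G (G z) - G z)) (hw : G w ∈ Ioo z (G z)) :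
    (1 / (1 + 5 * B)) ^ 2 ≤ orbitCrossRatio G w := by
  refine le_crossRatio (by positivity) (hlt _) (hlt _) (hlt _) (hmin _) (hmin _) ?_
  calc G (G w) - G w ≤ G (G z) - z := sub_le_sub (hG hw.2).le hw.1.le
    _ ≤ (4 * B + 1) * (G (G z) - G z) := by linarith
    _ ≤ 5 * B * (G (G z) - G z) :=
        mul_le_mul_of_nonneg_right (by linarith) (sub_nonneg.2 (hlt _).le)

theorem exists_forall_displacement_le {G : CircleDeg1Lift} (hG : Continuous G) :
    ∃ z : ℝ, ∀ x : ℝ, G z - z ≤ G x - x := by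
  obtain ⟨z, -, hz⟩ := isCompact_Icc.exists_isMinOn (s := Icc (0 : ℝ) 1)
    (nonempty_Icc.2 zero_le_one) (f := fun u => G u - u) (by fun_prop)
  refine ⟨z, fun x => ?_⟩
  have := hz ⟨Int.fract_nonneg x, (Int.fract_lt_one x).le⟩
  simpa only [mem_ofPred_eq, CircleDeg1Lift.map_fract_sub_fract_eq] using this

/-- `G` is a homeomorphism of the line moving every point to the right, which `h` semiconjugates to
the translation by `s`, and whose displacements at `x` and at `G x` differ at most by the
factor `D`. -/
structure ComparableDisplacement (h : ℝ → ℝ) (D s : ℝ) (G : CircleDeg1Lift) : Prop where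
  strictMono : StrictMono G
  surjective : Function.Surjective G
  semiconj : ∀ x, h (G x) = h x + s
  lt_map : ∀ x, x < G x
  le_mul : ∀ x, G (G x) - G x ≤ D * (G x - x)
  le_mul' : ∀ x, G x - x ≤ D * (G (G x) - G x)

theorem comparableDisplacement_of_le_orbitCrossRatio {h : ℝ → ℝ} {G : CircleDeg1Lift} {D s : ℝ}
    (hD : 0 < D) (hG : StrictMono G) (hsurj : Function.Surjective G)
    (hGs : ∀ x, h (G x) = h x + s) (hlt : ∀ x, x < G x)
    (hcr : ∀ x, 1 / D ≤ orbitCrossRatio G x) : ComparableDisplacement h D s G := by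
  have hends (x : ℝ) : G (G x) - x ≤ D * (G x - x) ∧
      G (G (G x)) - G x ≤ D * (G (G (G x)) - G (G x)) := by
    have := mul_le_of_le_crossRatio (hlt x) (hlt _) (hlt _) (hcr x)
    rwa [div_mul_eq_mul_div, one_mul, div_le_iff₀' hD, div_mul_eq_mul_div, one_mul,
      div_le_iff₀' hD] at this
  refine ⟨hG, hsurj, hGs, hlt, fun x => ?_, fun x => ?_⟩
  · linarith [(hends x).1, hlt x]
  · obtain ⟨y, rfl⟩ := hsurj x
    linarith [(hends y).2, hlt (G (G y))]

/-- If the displacement is minimal at `G z`, then the cross-ratios of the orbits through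
`[z, G z]` are bounded below, and the map carrying the orbit of `x` to such an orbit bounds the
cross-ratio at `x`. -/
theorem comparableDisplacement_of_orbitCrossRatio_le {h G : CircleDeg1Lift} {B s : ℝ}
    (hB : 1 ≤ B) (hG : StrictMono G) (hGc : Continuous G) (hlt : ∀ x, x < G x)
    (hGs : ∀ x, h (G x) = h x + s)
    (hcr_map : ∀ x, orbitCrossRatio G (G x) ≤ B * orbitCrossRatio G x)
    (hcr_hit : ∀ x u, ∃ w, orbitCrossRatio G w ≤ B * orbitCrossRatio G x ∧
      h (G w) ∈ Ioo u (u + s)) :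
    ComparableDisplacement h ((1 + 5 * B) ^ 2 * B) s G := by
  have hsurj : Function.Surjective G := G.continuous_iff_surjective.1 hGc
  obtain ⟨z, hmin⟩ := exists_forall_displacement_le hGc
  obtain ⟨z₁, rfl⟩ := hsurj z
  have hz₁ : G z₁ - z₁ ≤ 4 * B * (G (G z₁) - G z₁) := by
    obtain ⟨z₂, rfl⟩ := hsurj z₁
    exact sub_le_mul_of_orbitCrossRatio_le (by linarith) hlt hmin (hcr_map z₂)
  refine comparableDisplacement_of_le_orbitCrossRatio (by positivity) hG hsurj hGs hlt fun x => ?_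
  obtain ⟨w, hw, hmem⟩ := hcr_hit x (h z₁)
  rw [← hGs] at hmem
  have hwz : G w ∈ Ioo z₁ (G z₁) :=
    ⟨h.monotone.reflect_lt hmem.1, h.monotone.reflect_lt hmem.2⟩
  have hle := (le_orbitCrossRatio_of_mem_Ioo hB hG hlt hmin hz₁ hwz).trans hw
  rw [div_le_iff₀ (by positivity)]
  rw [div_pow, one_pow, div_le_iff₀ (by positivity)] at hle
  linarith

theorem exists_eq_iterate_sub_int (F : CircleDeg1Lift) (q : ℕ) (p : ℤ) :
    ∃ G : CircleDeg1Lift, ∀ x, G x = F^[q] x - p :=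
  ⟨↑(CircleDeg1Lift.translate (Multiplicative.ofAdd (-p : ℝ))) * F ^ q, fun x => by
    simp [neg_add_eq_sub, CircleDeg1Lift.coe_pow]⟩

theorem orbitCrossRatio_iterate_sub_int {F G : CircleDeg1Lift} {q : ℕ} {p : ℤ}
    (hGF : ∀ x, G x = F^[q] x - p) (k : ℕ) (m : ℤ) (x : ℝ) :
    orbitCrossRatio G (F^[k] x - m) =
      crossRatio (F^[k] x) (F^[k] (G x)) (F^[k] (G (G x))) (F^[k] (G (G (G x)))) := by
  have hcomm (x : ℝ) : F^[k] (G x) = G (F^[k] x) := by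
    rw [hGF, hGF, ← CircleDeg1Lift.coe_pow F k, CircleDeg1Lift.map_sub_int, CircleDeg1Lift.coe_pow,
      ← Function.iterate_add_apply, ← Function.iterate_add_apply, add_comm]
  simp only [orbitCrossRatio, CircleDeg1Lift.map_sub_int, crossRatio_sub, hcomm]

/-- At every scale `t ≤ 1`, up to the factor `n`, there is a lift with `D`-comparable
displacements. -/
def HasComparableDisplacements (h : ℝ → ℝ) (D : ℝ) (n : ℕ) : Prop :=
  ∀ t, 0 < t → t ≤ 1 → ∃ (s : ℝ) (G : CircleDeg1Lift),
    0 < s ∧ s ≤ t ∧ t ≤ n * s ∧ ComparableDisplacement h D s G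

theorem exists_forall_exists_div_le {A : ℝ} (hA : 0 < A) (N₀ : ℕ) :
    ∃ n : ℕ, ∀ t : ℝ, 0 < t → t ≤ 1 → ∃ N ≥ N₀, 0 < N ∧ 2 * A / N ≤ t ∧ t ≤ n * (A / N) := by
  obtain ⟨n, hn⟩ := exists_nat_ge ((N₀ + 2 * A + 1) / A)
  refine ⟨n, fun t ht ht1 => ?_⟩
  have hceil_pos : 0 < ⌈2 * A / t⌉₊ := Nat.ceil_pos.2 (by positivity)
  refine ⟨N₀ + ⌈2 * A / t⌉₊, by lia, by lia, ?_, ?_⟩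
  · have : 2 * A / t ≤ (N₀ + ⌈2 * A / t⌉₊ : ℕ) := (Nat.le_ceil _).trans (by exact_mod_cast by lia)
    exact div_le_of_le_mul₀ (by positivity) ht.le ((div_le_iff₀' ht).1 this)
  · have hceil : (⌈2 * A / t⌉₊ : ℝ) ≤ 2 * A / t + 1 := (Nat.ceil_lt_add_one (by positivity)).le
    have hmul : t * (N₀ + ⌈2 * A / t⌉₊ : ℕ) ≤ N₀ + 2 * A + 1 := by
      push_cast
      calc t * (N₀ + ⌈2 * A / t⌉₊) ≤ t * (N₀ + (2 * A / t + 1)) := by gcongr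
        _ = t * (N₀ + 1) + 2 * A := by field_simp; ring
        _ ≤ 1 * (N₀ + 1) + 2 * A := by gcongr
        _ = N₀ + 2 * A + 1 := by ring
    rw [mul_div_assoc', le_div_iff₀ (by exact_mod_cast by lia)]
    exact hmul.trans ((div_le_iff₀ hA).1 hn)

/-- The lifts are the close returns `F^[q] - p` with `q ≤ N`, where `N` iterates suffice for the
orbits of the translation by `α` to enter, modulo one, every interval of length `A / N`. -/
theorem exists_hasComparableDisplacements {F h : CircleDeg1Lift} {α c₀ M : ℝ} {S : Finset ℝ}
    (hF : StrictMono F) (hFc : Continuous F) (hsemi : ∀ x, h (F x) = h x + α) (hc₀ : 0 < c₀)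
    (hbad : BadlyApproximableWith c₀ α) (hM : 1 ≤ M) (hB : CrossRatioBounds F M S) :
    ∃ (D : ℝ) (n : ℕ), 1 ≤ D ∧ HasComparableDisplacements h D n := by
  set A : ℝ := 2 + 1 / c₀ with hA
  have hA0 : 0 < A := by positivity
  obtain ⟨B, hB1, hBcr⟩ := exists_crossRatio_iterate_le hF hsemi hc₀ hbad hM hB (6 * A)
  obtain ⟨N₀, hN₀⟩ := exists_nat_gt (6 * A)
  obtain ⟨n, hn⟩ := exists_forall_exists_div_le hA0 N₀
  refine ⟨(1 + 5 * B) ^ 2 * B, n, one_le_mul_of_one_le_of_one_le (one_le_pow₀ (by linarith)) hB1,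
    fun t ht ht1 => ?_⟩
  obtain ⟨N, hN, hN1, hNt, htN⟩ := hn t ht ht1
  have hNpos : (0 : ℝ) < N := by exact_mod_cast hN1
  have hsmall : 6 * A / N < 1 := (div_lt_one hNpos).2 (hN₀.trans_le (by exact_mod_cast hN))
  obtain ⟨q, p, -, hqN, hs, hs'⟩ := hbad.exists_mem_Ioo hc₀ hN1 (A / N)
  rw [← hA, ← add_div, ← two_mul] at hs'
  obtain ⟨G, hGF⟩ := exists_eq_iterate_sub_int F q p
  have hGs (x : ℝ) : h (G x) = h x + (q * α - p) := by
    rw [hGF, h.map_sub_int, map_iterate_of_map_eq_add hsemi, add_sub_assoc]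
  have hspos : 0 < q * α - p := hs.trans' (by positivity)
  have hlt (x : ℝ) : x < G x := h.monotone.reflect_lt (by rw [hGs]; linarith)
  have h6 : 6 * A / N = 3 * (2 * A / N) := by ring
  have hcr (x : ℝ) (k : ℕ) (hk : k ≤ N) (m : ℤ) :
      orbitCrossRatio G (F^[k] x - m) ≤ B * orbitCrossRatio G x := by
    rw [orbitCrossRatio_iterate_sub_int hGF]
    refine hBcr N hN1 _ _ _ _ (hlt _) (hlt _) (hlt _) ?_ ?_ k hk <;> · simp only [hGs]; linarith
  refine ⟨q * α - p, G, hspos, hs'.le.trans hNt, htN.trans (by gcongr),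
    comparableDisplacement_of_orbitCrossRatio_le hB1 ?_ ?_ hlt hGs ?_ ?_⟩
  · exact fun x y hxy => by simpa only [hGF, sub_lt_sub_iff_right] using hF.iterate q hxy
  · exact (funext hGF : ⇑G = _) ▸ (hFc.iterate q).sub continuous_const
  · exact fun x => by simpa only [hGF x] using hcr x q hqN p
  · intro x u
    obtain ⟨k, m, -, hkN, hk⟩ := hbad.exists_mem_Ioo hc₀ hN1 (u - h (G x))
    refine ⟨F^[k] x - m, hcr x k hkN m, ?_⟩
    rw [← hA] at hk
    rw [hGs, h.map_sub_int, map_iterate_of_map_eq_add hsemi]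
    rw [hGs] at hk
    exact ⟨by linarith [hk.1], by linarith [hk.2]⟩

/-! ### Quasisymmetric maps of the line -/

/-- Over adjacent intervals of length `s`, the increment of `H` over the right one is at most `D`
times the increment over the left one. -/
def IncrementLE (H : ℝ → ℝ) (D s : ℝ) : Prop :=
  ∀ v, H (v + s) - H v ≤ D * (H v - H (v - s))

/-- Conjugation by `x ↦ -x`, which exchanges left and right in `IncrementLE`. -/
def reflect (H : ℝ → ℝ) (x : ℝ) : ℝ :=
  -H (-x)

/-- Quasisymmetry on the line: both ratios of the increments of `H` over adjacent intervals of equal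
lengths are at most `D`. -/
def IsQuasisymmetricWith (H : ℝ → ℝ) (D : ℝ) : Prop :=
  ∀ s, 0 < s → IncrementLE H D s ∧ IncrementLE (reflect H) D s

theorem reflect_reflect (H : ℝ → ℝ) : reflect (reflect H) = H :=
  funext fun x => by simp only [reflect, neg_neg]

theorem monotone_reflect {H : ℝ → ℝ} (hH : Monotone H) : Monotone (reflect H) :=
  fun _ _ hxy => neg_le_neg (hH (neg_le_neg hxy))

theorem strictMono_reflect {H : ℝ → ℝ} (hH : StrictMono H) : StrictMono (reflect H) :=
  fun _ _ hxy => neg_lt_neg (hH (neg_lt_neg hxy))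

theorem incrementLE_reflect {H : ℝ → ℝ} {D s : ℝ} :
    IncrementLE (reflect H) D s ↔ ∀ v, H v - H (v - s) ≤ D * (H (v + s) - H v) := by
  refine ⟨fun h v => ?_, fun h v => ?_⟩ <;>
  · have := h (-v)
    simp only [reflect, neg_neg, neg_add, neg_sub', sub_neg_eq_add, ← sub_eq_add_neg] at this ⊢
    linarith

theorem IncrementLE.mono {H : ℝ → ℝ} {D D' s : ℝ} (h : IncrementLE H D s)
    (hH : Monotone H) (hs : 0 ≤ s) (hD : D ≤ D') : IncrementLE H D' s := fun v =>
  (h v).trans (mul_le_mul_of_nonneg_right hD (sub_nonneg.2 (hH (sub_le_self v hs))))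

theorem IncrementLE.sub_le_pow_mul {H : ℝ → ℝ} {D s : ℝ} (hD : 0 ≤ D) (h : IncrementLE H D s)
    (n : ℕ) (v : ℝ) : H (v + n * s) - H (v + n * s - s) ≤ D ^ n * (H v - H (v - s)) := by
  induction n with
  | zero => simp
  | succ n ih =>
    rw [show v + (n + 1 : ℕ) * s = v + n * s + s by push_cast; ring, add_sub_cancel_right,
      pow_succ', mul_assoc]
    exact (h _).trans (mul_le_mul_of_nonneg_left ih hD)

theorem IncrementLE.sub_le_mul {H : ℝ → ℝ} {D s : ℝ} (hD : 1 ≤ D) (h : IncrementLE H D s)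
    (hH : Monotone H) (hs : 0 ≤ s) (n : ℕ) (v : ℝ) :
    H (v + n * s) - H v ≤ n * D ^ n * (H v - H (v - s)) := by
  have h₀ : 0 ≤ H v - H (v - s) := sub_nonneg.2 (hH (sub_le_self v hs))
  induction n with
  | zero => simp
  | succ n ih =>
    have hlast := h.sub_le_pow_mul (zero_le_one.trans hD) (n + 1) v
    have hsucc : v + (n + 1 : ℕ) * s = v + n * s + s := by push_cast; ring
    rw [hsucc, add_sub_cancel_right] at hlast
    rw [hsucc]
    have : n * D ^ n * (H v - H (v - s)) ≤ n * D ^ (n + 1) * (H v - H (v - s)) := by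
      gcongr
      exact n.le_succ
    push_cast
    linarith

theorem IncrementLE.of_le_mul {H : ℝ → ℝ} {D s t : ℝ} {n : ℕ} (hD : 1 ≤ D) (h : IncrementLE H D s)
    (hH : Monotone H) (hs : 0 ≤ s) (hst : s ≤ t) (htn : t ≤ n * s) :
    IncrementLE H (n * D ^ n) t := by
  intro v
  calc H (v + t) - H v ≤ H (v + n * s) - H v := by
        gcongr
        exact hH (by gcongr)
    _ ≤ n * D ^ n * (H v - H (v - s)) := h.sub_le_mul hD hH hs n v
    _ ≤ n * D ^ n * (H v - H (v - t)) := by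
        gcongr
        exact hH (by gcongr)

theorem IncrementLE.comp {H φ : ℝ → ℝ} {D M s : ℝ} {n : ℕ} (hD : 1 ≤ D) (hH : Monotone H)
    (hHD : ∀ t, 0 < t → IncrementLE H D t) (hφ : StrictMono φ) (hφM : IncrementLE φ M s)
    (hs : 0 < s) (hn : M ≤ n) : IncrementLE (H ∘ φ) (n * D ^ n) s := by
  intro v
  have hpos : 0 < φ v - φ (v - s) := sub_pos.2 (hφ (sub_lt_self v hs))
  have hstep : φ (v + s) ≤ φ v + n * (φ v - φ (v - s)) := by
    linarith [(hφM v).trans (mul_le_mul_of_nonneg_right hn hpos.le)]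
  have hiter := (hHD _ hpos).sub_le_mul hD hH hpos.le n (φ v)
  rw [sub_sub_cancel] at hiter
  exact (sub_le_sub_right (hH hstep) _).trans hiter

namespace IsQuasisymmetricWith

theorem reflect {H : ℝ → ℝ} {D : ℝ} (h : IsQuasisymmetricWith H D) :
    IsQuasisymmetricWith (reflect H) D := fun s hs =>
  ⟨(h s hs).2, (reflect_reflect H).symm ▸ (h s hs).1⟩

theorem one_le {H : ℝ → ℝ} {D : ℝ} (hH : StrictMono H) (h : IsQuasisymmetricWith H D) :
    1 ≤ D := by
  by_contra! hlt
  have hright := (h 1 one_pos).1 0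
  have hleft := incrementLE_reflect.1 (h 1 one_pos).2 0
  have hpos : 0 < H 0 - H (0 - 1) := sub_pos.2 (hH (by norm_num))
  have hpos' : 0 < H (0 + 1) - H 0 := sub_pos.2 (hH (by norm_num))
  nlinarith

theorem comp {H φ : ℝ → ℝ} {D M : ℝ} (hφ : IsQuasisymmetricWith φ M) (hH : StrictMono H)
    (hHD : IsQuasisymmetricWith H D) (hφm : StrictMono φ) :
    ∃ K, IsQuasisymmetricWith (H ∘ φ) K := by
  have hreflect : CircleMap.reflect H ∘ CircleMap.reflect φ = CircleMap.reflect (H ∘ φ) :=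
    funext fun x => by simp only [CircleMap.reflect, Function.comp_apply, neg_neg]
  obtain ⟨n, hn⟩ := exists_nat_ge M
  have hD := hHD.one_le hH
  refine ⟨n * D ^ n, fun s hs => ⟨?_, hreflect ▸ ?_⟩⟩
  · exact IncrementLE.comp hD hH.monotone (fun t ht => (hHD t ht).1) hφm (hφ s hs).1 hs hn
  · exact IncrementLE.comp hD (monotone_reflect hH.monotone) (fun t ht => (hHD t ht).2)
      (strictMono_reflect hφm) (hφ s hs).2 hs hn

theorem add_const {H : ℝ → ℝ} {D : ℝ} (h : IsQuasisymmetricWith H D) (a : ℝ) :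
    IsQuasisymmetricWith (fun x => H x + a) D := by
  refine fun s hs => ⟨fun v => ?_, incrementLE_reflect.2 fun v => ?_⟩
  · simpa only [add_sub_add_right_eq_sub] using (h s hs).1 v
  · simpa only [add_sub_add_right_eq_sub] using incrementLE_reflect.1 (h s hs).2 v

theorem pow_mul_le_sub {H : ℝ → ℝ} {D r v : ℝ} (hD : 0 < D) (h : IsQuasisymmetricWith H D)
    (hr : 0 < r) (n : ℕ) :
    (1 + 1 / D) ^ n * ((H v - H (v - r)) / D) ≤ H (v + 2 ^ n * r) - H v := by
  have hdiv (s x : ℝ) (hs : 0 < s) : (H x - H (x - s)) / D ≤ H (x + s) - H x :=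
    (div_le_iff₀' hD).2 (incrementLE_reflect.1 (h s hs).2 x)
  induction n with
  | zero => simpa only [pow_zero, one_mul] using hdiv r v hr
  | succ n ih =>
    have hlast := hdiv (2 ^ n * r) (v + 2 ^ n * r) (by positivity)
    rw [add_sub_cancel_right] at hlast
    calc (1 + 1 / D) ^ (n + 1) * ((H v - H (v - r)) / D)
        = (1 + 1 / D) * ((1 + 1 / D) ^ n * ((H v - H (v - r)) / D)) := by ring
      _ ≤ (1 + 1 / D) * (H (v + 2 ^ n * r) - H v) := by gcongr
      _ = (H (v + 2 ^ n * r) - H v) + (H (v + 2 ^ n * r) - H v) / D := by ring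
      _ ≤ H (v + 2 ^ n * r + 2 ^ n * r) - H v := by linarith
      _ = H (v + 2 ^ (n + 1) * r) - H v := by rw [add_assoc, ← two_mul, pow_succ', mul_assoc]

theorem exists_incrementLE_inverse {H h : ℝ → ℝ} {D : ℝ} (hHD : IsQuasisymmetricWith H D)
    (hH : StrictMono H) (hh : StrictMono h) (hHh : ∀ x, H (h x) = x) :
    ∃ n : ℕ, ∀ s, 0 < s → IncrementLE h (2 ^ n) s := by
  have hD : 0 < D := zero_lt_one.trans_le (hHD.one_le hH)
  obtain ⟨n, hn⟩ := pow_unbounded_of_one_lt D (lt_add_of_pos_right 1 (one_div_pos.2 hD))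
  refine ⟨n, fun s hs x => ?_⟩
  have hgrowth := hHD.pow_mul_le_sub (v := h x) hD (sub_pos.2 (hh (sub_lt_self x hs))) n
  rw [sub_sub_cancel, hHh, hHh, sub_sub_cancel] at hgrowth
  have hlarge : s ≤ (1 + 1 / D) ^ n * (s / D) := by
    rw [mul_div_assoc', le_div_iff₀ hD, mul_comm]
    gcongr
  by_contra! hcon
  have := hH (lt_sub_iff_add_lt'.1 hcon)
  rw [hHh] at this
  linarith

theorem inverse {H h : ℝ → ℝ} {D : ℝ} (hHD : IsQuasisymmetricWith H D) (hH : StrictMono H)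
    (hh : StrictMono h) (hHh : ∀ x, H (h x) = x) : ∃ K, IsQuasisymmetricWith h K := by
  obtain ⟨i, hi⟩ := hHD.exists_incrementLE_inverse hH hh hHh
  obtain ⟨j, hj⟩ := hHD.reflect.exists_incrementLE_inverse (strictMono_reflect hH)
    (strictMono_reflect hh) fun x => by simp only [CircleMap.reflect, neg_neg, hHh]
  exact ⟨max (2 ^ i) (2 ^ j), fun s hs => ⟨(hi s hs).mono hh.monotone hs.le (le_max_left _ _),
    (hj s hs).mono (monotone_reflect hh.monotone) hs.le (le_max_right _ _)⟩⟩

end IsQuasisymmetricWith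

/-! ### Linearization -/

namespace ComparableDisplacement

variable {h : ℝ → ℝ} {D s s' : ℝ} {G G' : CircleDeg1Lift}

theorem map_map_lt (hh : Monotone h) (hG : ComparableDisplacement h D s G)
    (hG' : ComparableDisplacement h D s' G') (hs : 2 * s' < s) (x : ℝ) : G' (G' x) < G x :=
  hh.reflect_lt (by rw [hG.semiconj, hG'.semiconj, hG'.semiconj]; linarith)

theorem sub_le_div_mul (hD : 0 ≤ D) (hh : Monotone h) (hG : ComparableDisplacement h D s G)
    (hG' : ComparableDisplacement h D s' G') (hs : 2 * s' < s) (x : ℝ) :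
    G' x - x ≤ D / (D + 1) * (G x - x) := by
  rw [div_mul_eq_mul_div, le_div_iff₀ (by linarith)]
  linarith [hG'.le_mul' x, mul_le_mul_of_nonneg_left (hG.map_map_lt hh hG' hs x).le hD]

end ComparableDisplacement

namespace HasComparableDisplacements

theorem exists_sub_le_pow_mul {h : ℝ → ℝ} {D : ℝ} {n : ℕ} (hD : 0 ≤ D) (hh : Monotone h)
    (hcd : HasComparableDisplacements h D n) (x : ℝ) :
    ∃ C, ∀ k : ℕ, ∃ (s : ℝ) (G : CircleDeg1Lift), 0 < s ∧ s ≤ 1 ∧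
      ComparableDisplacement h D s G ∧ G x - x ≤ (D / (D + 1)) ^ k * C := by
  obtain ⟨s₀, G₀, hs₀, hs₀1, -, hG₀⟩ := hcd 1 one_pos le_rfl
  refine ⟨G₀ x - x, fun k => ?_⟩
  induction k with
  | zero => exact ⟨s₀, G₀, hs₀, hs₀1, hG₀, by rw [pow_zero, one_mul]⟩
  | succ k ih =>
    obtain ⟨s, G, hs, hs1, hG, hle⟩ := ih
    obtain ⟨s', G', hs', hs's, -, hG'⟩ := hcd (s / 3) (by positivity) (by linarith)
    refine ⟨s', G', hs', by linarith, hG', ?_⟩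
    calc G' x - x ≤ D / (D + 1) * (G x - x) := hG.sub_le_div_mul hD hh hG' (by linarith) x
      _ ≤ D / (D + 1) * ((D / (D + 1)) ^ k * (G₀ x - x)) := by gcongr
      _ = (D / (D + 1)) ^ (k + 1) * (G₀ x - x) := by ring

/-- The displacements at `x` shrink geometrically with the scale, but each of them bounds the length
of an interval `[x, y]` on which `h` is constant. -/
theorem strictMono {h : ℝ → ℝ} {D : ℝ} {n : ℕ} (hD : 0 ≤ D) (hh : Monotone h)
    (hcd : HasComparableDisplacements h D n) : StrictMono h := by
  refine fun x y hxy => (hh hxy.le).lt_of_ne fun heq => ?_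
  obtain ⟨C, hC⟩ := hcd.exists_sub_le_pow_mul hD hh x
  have hratio : Tendsto (fun k : ℕ => (D / (D + 1)) ^ k * C) atTop (𝓝 0) := by
    simpa only [zero_mul] using (tendsto_pow_atTop_nhds_zero_of_lt_one (by positivity)
      ((div_lt_one (by linarith)).2 (lt_add_one D))).mul_const C
  obtain ⟨k, hk⟩ := (hratio.eventually_lt_const (sub_pos.2 hxy)).exists
  obtain ⟨s, G, hs, -, hG, hle⟩ := hC k
  have : y < G x := hh.reflect_lt (by rw [hG.semiconj]; linarith)
  linarith

end HasComparableDisplacements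

theorem continuous_of_map_eq_add {F h : CircleDeg1Lift} {α c₀ : ℝ}
    (hsemi : ∀ x, h (F x) = h x + α) (hc₀ : 0 < c₀) (hbad : BadlyApproximableWith c₀ α) :
    Continuous h := by
  refine h.monotone.continuous_of_denseRange (dense_of_exists_between fun u v huv => ?_)
  have huv' : 0 < v - u := sub_pos.2 huv
  obtain ⟨N, hN⟩ := exists_nat_gt ((2 + 1 / c₀) / (v - u))
  have hN0 : (0 : ℝ) < N := lt_trans (by positivity) hN
  obtain ⟨i, p, -, -, hip⟩ := hbad.exists_mem_Ioo hc₀ (by exact_mod_cast hN0) (u - h 0)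
  have hgap : (2 + 1 / c₀) / N < v - u := (div_lt_comm₀ huv' hN0).1 hN
  refine ⟨h (F^[i] 0 - p), mem_range_self _, ?_⟩
  rw [h.map_sub_int, map_iterate_of_map_eq_add hsemi]
  exact ⟨by linarith [hip.1], by linarith [hip.2]⟩

theorem map_add_sub_map_mem_Icc (H : CircleDeg1Lift) (v t : ℝ) :
    H (v + t) - H v ∈ Icc (⌊t⌋ : ℝ) (⌊t⌋ + 1) := by
  have hlower := H.monotone (add_le_add_right (Int.floor_le t) v)
  have hupper := H.monotone (add_le_add_right (Int.lt_floor_add_one t).le v)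
  rw [H.map_add_int] at hlower
  rw [← add_assoc, H.map_add_one, H.map_add_int] at hupper
  exact ⟨by linarith, by linarith⟩

theorem incrementLE_of_one_le (H : CircleDeg1Lift) {t : ℝ} (ht : 1 ≤ t) :
    IncrementLE H 2 t ∧ IncrementLE (reflect H) 2 t := by
  have hfloor : (1 : ℝ) ≤ ⌊t⌋ := by exact_mod_cast Int.le_floor.2 (by exact_mod_cast ht)
  have hleft (v : ℝ) : H v - H (v - t) ∈ Icc (⌊t⌋ : ℝ) (⌊t⌋ + 1) := by
    simpa only [sub_add_cancel] using map_add_sub_map_mem_Icc H (v - t) t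
  have hright (v : ℝ) := map_add_sub_map_mem_Icc H v t
  refine ⟨fun v => ?_, incrementLE_reflect.2 fun v => ?_⟩
  · linarith [(hleft v).1, (hright v).2]
  · linarith [(hleft v).2, (hright v).1]

theorem ComparableDisplacement.incrementLE_inverse {h H : ℝ → ℝ} {D s : ℝ} {G : CircleDeg1Lift}
    (hG : ComparableDisplacement h D s G) (hHh : ∀ x, H (h x) = x) (hhH : ∀ x, h (H x) = x) :
    IncrementLE H D s ∧ IncrementLE (reflect H) D s := by
  have hright (v : ℝ) : H (v + s) = G (H v) := by rw [← hHh (G (H v)), hG.semiconj, hhH]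
  have hleft (v : ℝ) : H v = G (H (v - s)) := by rw [← hright, sub_add_cancel]
  refine ⟨fun v => ?_, incrementLE_reflect.2 fun v => ?_⟩
  · simpa only [← hleft, ← hright] using hG.le_mul (H (v - s))
  · simpa only [← hleft, ← hright] using hG.le_mul' (H (v - s))

theorem HasComparableDisplacements.isQuasisymmetricWith_inverse {h H : CircleDeg1Lift} {D : ℝ}
    {n : ℕ} (hD : 1 ≤ D) (hcd : HasComparableDisplacements h D n) (hHh : ∀ x, H (h x) = x)
    (hhH : ∀ x, h (H x) = x) : IsQuasisymmetricWith H (max 2 (n * D ^ n)) := by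
  have hmono := H.monotone
  have hmono' := monotone_reflect hmono
  intro t ht
  rcases le_or_gt t 1 with ht1 | ht1
  · obtain ⟨s, G, hs, hst, htn, hG⟩ := hcd t ht ht1
    obtain ⟨hinc, hinc'⟩ := hG.incrementLE_inverse hHh hhH
    exact ⟨(hinc.of_le_mul hD hmono hs.le hst htn).mono hmono ht.le (le_max_right _ _),
      (hinc'.of_le_mul hD hmono' hs.le hst htn).mono hmono' ht.le (le_max_right _ _)⟩
  · obtain ⟨hinc, hinc'⟩ := incrementLE_of_one_le H ht1.le
    exact ⟨hinc.mono hmono ht.le (le_max_left _ _), hinc'.mono hmono' ht.le (le_max_left _ _)⟩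

/-- A circle homeomorphism with a lift that is power-like at every point, for instance a
multicritical circle map or a `C^2` diffeomorphism. -/
def IsPowerLike (f : UnitAddCircle ≃ₜ UnitAddCircle) : Prop :=
  ∃ F : CircleDeg1Lift, IsLift F f ∧ ∀ x, ∃ d, IsPowerLikeAt F x d

/-- The homeomorphism `h` of the line conjugates the lift `F` of `f` to the translation by `α`, and
its inverse is quasisymmetric. Using a unit of `CircleDeg1Lift` for `h` bundles the inverse. -/
structure IsLinearization (f : UnitAddCircle ≃ₜ UnitAddCircle) (F : CircleDeg1Lift)
    (h : CircleDeg1Liftˣ) (α K : ℝ) : Prop where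
  isLift : IsLift F f
  semiconj : ∀ x, h (F x) = h x + α
  fract_eq : Int.fract α = rotationNumber f
  quasisymmetric : IsQuasisymmetricWith (h⁻¹ : CircleDeg1Liftˣ) K

theorem exists_map_eq_add_translationNumber {F : CircleDeg1Lift} (hF : StrictMono F)
    (hFc : Continuous F) : ∃ h : CircleDeg1Lift, ∀ x, h (F x) = h x + F.translationNumber := by
  have hbij : Function.Bijective F := ⟨hF.injective, F.continuous_iff_surjective.1 hFc⟩
  obtain ⟨h, hh⟩ := CircleDeg1Lift.semiconj_of_isUnit_of_translationNumber_eq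
    (CircleDeg1Lift.isUnit_iff_bijective.2 hbij)
    (CircleDeg1Lift.translate (Multiplicative.ofAdd F.translationNumber)).isUnit
    (CircleDeg1Lift.translationNumber_translate _).symm
  exact ⟨h, fun x => by rw [hh x, CircleDeg1Lift.translate_apply, add_comm]⟩

theorem IsPowerLike.exists_isLinearization {f : UnitAddCircle ≃ₜ UnitAddCircle}
    (hf : IsPowerLike f) {c₀ : ℝ} (hc₀ : 0 < c₀)
    (hbad : BadlyApproximableWith c₀ (rotationNumber f)) :
    ∃ F h α K, IsLinearization f F h α K := by
  obtain ⟨F, hF, hpower⟩ := hf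
  have hrot := rotationNumber_eq hF
  have hbadF : BadlyApproximableWith c₀ F.translationNumber := by
    simpa only [hrot, Int.fract_add_floor] using hbad.add_int ⌊F.translationNumber⌋
  obtain ⟨h, hsemi⟩ := exists_map_eq_add_translationNumber hF.strictMono hF.continuous
  obtain ⟨M, S, hM, hB⟩ := exists_crossRatioBounds hF.strictMono hF.continuous hpower
  obtain ⟨D, n, hD, hcd⟩ := exists_hasComparableDisplacements hF.strictMono hF.continuous hsemi
    hc₀ hbadF hM hB
  have hmono := hcd.strictMono (zero_le_one.trans hD) h.monotone
  have hcont := continuous_of_map_eq_add hsemi hc₀ hbadF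
  obtain ⟨u, rfl⟩ := CircleDeg1Lift.isUnit_iff_bijective.2
    ⟨hmono.injective, h.continuous_iff_surjective.1 hcont⟩
  exact ⟨F, u, F.translationNumber, _, hF, hsemi, hrot.symm,
    hcd.isQuasisymmetricWith_inverse hD (CircleDeg1Lift.units_inv_apply_apply u)
      (CircleDeg1Lift.units_apply_inv_apply u)⟩

/-! ### Conjugacies on the circle -/

theorem strictMono_coe_units (u : CircleDeg1Liftˣ) : StrictMono u :=
  (CircleDeg1Lift.toOrderIso u).strictMono

theorem continuous_coe_units (u : CircleDeg1Liftˣ) : Continuous u :=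
  (CircleDeg1Lift.toOrderIso u).continuous

/-- The circle map with lift `P`. -/
noncomputable def toCircleFun (P : CircleDeg1Lift) : UnitAddCircle → UnitAddCircle :=
  Function.Periodic.lift (f := fun x : ℝ => ((P x : ℝ) : UnitAddCircle)) (c := 1) fun x => by
    simp only [P.map_add_one, AddCircle.coe_add, AddCircle.coe_period, add_zero]

theorem continuous_toCircleFun {P : CircleDeg1Lift} (hP : Continuous P) :
    Continuous (toCircleFun P) := by
  rw [(QuotientAddGroup.isQuotientMap_mk (N := AddSubgroup.zmultiples (1 : ℝ))).continuous_iff]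
  exact (AddCircle.continuous_mk' (1 : ℝ)).comp hP

/-- The circle homeomorphism with lift `u`. -/
noncomputable def toCircleHomeo (u : CircleDeg1Liftˣ) : UnitAddCircle ≃ₜ UnitAddCircle where
  toFun := toCircleFun u
  invFun := toCircleFun (u⁻¹ : CircleDeg1Liftˣ)
  left_inv y := by
    induction y using QuotientAddGroup.induction_on with
    | H x => exact congrArg _ (CircleDeg1Lift.units_inv_apply_apply u x)
  right_inv y := by
    induction y using QuotientAddGroup.induction_on with
    | H x => exact congrArg _ (CircleDeg1Lift.units_apply_inv_apply u x)
  continuous_toFun := continuous_toCircleFun (continuous_coe_units u)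
  continuous_invFun := continuous_toCircleFun (continuous_coe_units u⁻¹)

theorem toCircleHomeo_coe (u : CircleDeg1Liftˣ) (x : ℝ) :
    toCircleHomeo u (x : UnitAddCircle) = (u x : ℝ) := rfl

theorem toCircleHomeo_symm_coe (u : CircleDeg1Liftˣ) (x : ℝ) :
    (toCircleHomeo u).symm (x : UnitAddCircle) = ((u⁻¹ : CircleDeg1Liftˣ) x : ℝ) := rfl

theorem eq_add_of_commute_rotation {α : ℝ} (hα : Irrational α) {φ : UnitAddCircle → UnitAddCircle}
    (hφ : Continuous φ) (hcomm : ∀ y, φ (y + (α : UnitAddCircle)) = φ y + (α : UnitAddCircle))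
    (y : UnitAddCircle) : φ y = y + φ 0 := by
  have horbit (n : ℤ) : φ (n • (α : UnitAddCircle)) = n • (α : UnitAddCircle) + φ 0 := by
    induction n with
    | zero => rw [zero_zsmul, zero_add]
    | succ n ih => rw [add_zsmul, one_zsmul, hcomm, ih]; abel
    | pred n ih =>
      have := hcomm ((-(n : ℤ) - 1) • (α : UnitAddCircle))
      rw [sub_zsmul, one_zsmul, neg_add_cancel_right, ih] at this
      rw [sub_zsmul, one_zsmul, ← sub_eq_iff_eq_add.2 this]
      abel
  have hdense : DenseRange fun n : ℤ => n • (α : UnitAddCircle) := by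
    rw [AddCircle.denseRange_zsmul_coe_iff, div_one]
    exact hα
  exact congrFun (hdense.equalizer hφ (continuous_id.add continuous_const) (funext horbit)) y

theorem coe_eq_coe_of_fract_eq {α β : ℝ} (h : Int.fract α = Int.fract β) :
    (α : UnitAddCircle) = (β : UnitAddCircle) := by
  obtain ⟨m, hm⟩ := Int.fract_eq_fract.1 h
  rw [← sub_eq_zero, ← AddCircle.coe_sub, AddCircle.coe_eq_zero_iff]
  exact ⟨m, by rw [zsmul_one, hm]⟩

theorem IsQuasisymmetricWith.isQuasisymmetric {k : UnitAddCircle ≃ₜ UnitAddCircle}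
    {P : CircleDeg1Lift} {K : ℝ} (h : IsQuasisymmetricWith P K) (hP : IsLift P k) :
    IsQuasisymmetric k := by
  have hK := h.one_le hP.strictMono
  refine ⟨P, hP, K, hK, fun x t ht => ?_⟩
  have hpos : 0 < P x - P (x - t) := sub_pos.2 (hP.strictMono (sub_lt_self x ht))
  refine ⟨?_, (div_le_iff₀ hpos).2 ((h t ht).1 x)⟩
  rw [div_le_div_iff₀ (by linarith) hpos, one_mul, mul_comm]
  exact incrementLE_reflect.1 (h t ht).2 x

section Conjugacy

variable {f g k : UnitAddCircle ≃ₜ UnitAddCircle} {F G : CircleDeg1Lift} {h h' : CircleDeg1Liftˣ}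
  {α β K K' : ℝ}

theorem IsLinearization.toCircleHomeo_apply (L : IsLinearization f F h α K) (y : UnitAddCircle) :
    toCircleHomeo h (f y) = toCircleHomeo h y + α := by
  induction y using QuotientAddGroup.induction_on with
  | H x =>
    rw [← L.isLift.coe_eq, toCircleHomeo_coe, L.semiconj, AddCircle.coe_add, toCircleHomeo_coe]

theorem IsLinearization.exists_isConjugacy (L : IsLinearization f F h α K)
    (L' : IsLinearization g G h' β K') (hαβ : (α : UnitAddCircle) = β) :
    ∃ k, IsConjugacy k f g := by
  refine ⟨(toCircleHomeo h).trans (toCircleHomeo h').symm, fun y => ?_⟩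
  simp only [Homeomorph.trans_apply]
  rw [L.toCircleHomeo_apply, Homeomorph.symm_apply_eq, L'.toCircleHomeo_apply,
    Homeomorph.apply_symm_apply, hαβ]

theorem IsLinearization.exists_apply_eq_add (L : IsLinearization f F h α K)
    (L' : IsLinearization g G h' β K') (hαβ : (α : UnitAddCircle) = β) (hα : Irrational α)
    (hk : IsConjugacy k f g) :
    ∃ a : ℝ, ∀ y, toCircleHomeo h' (k y) = toCircleHomeo h y + (a : UnitAddCircle) := by
  let φ : UnitAddCircle ≃ₜ UnitAddCircle :=
    ((toCircleHomeo h).symm.trans k).trans (toCircleHomeo h')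
  have hφ (y : UnitAddCircle) : φ (toCircleHomeo h y) = toCircleHomeo h' (k y) :=
    congrArg (fun z => toCircleHomeo h' (k z)) ((toCircleHomeo h).symm_apply_apply y)
  have hcomm (y : UnitAddCircle) : φ (y + α) = φ y + α := by
    obtain ⟨z, rfl⟩ := (toCircleHomeo h).surjective y
    rw [← L.toCircleHomeo_apply, hφ, hφ, hk, L'.toCircleHomeo_apply, hαβ]
  obtain ⟨a, ha⟩ := QuotientAddGroup.mk_surjective (φ 0)
  exact ⟨a, fun y => by
    rw [← hφ, eq_add_of_commute_rotation hα φ.continuous hcomm, ← ha]⟩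

theorem isLift_of_toCircleHomeo_apply_eq_add {a : ℝ}
    (ha : ∀ y, toCircleHomeo h' (k y) = toCircleHomeo h y + (a : UnitAddCircle)) :
    IsLift (h'⁻¹ * CircleDeg1Lift.translate (Multiplicative.ofAdd a) * h : CircleDeg1Liftˣ) k := by
  refine ⟨continuous_coe_units _, strictMono_coe_units _, fun x => ?_⟩
  rw [← (toCircleHomeo h').symm_apply_apply (k x), ha, toCircleHomeo_coe, ← AddCircle.coe_add,
    toCircleHomeo_symm_coe, add_comm]
  rfl

theorem IsLinearization.isQuasisymmetric_of_isConjugacy (L : IsLinearization f F h α K)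
    (L' : IsLinearization g G h' β K') (hαβ : (α : UnitAddCircle) = β) (hα : Irrational α)
    (hk : IsConjugacy k f g) : IsQuasisymmetric k := by
  obtain ⟨a, ha⟩ := L.exists_apply_eq_add L' hαβ hα hk
  obtain ⟨M, hM⟩ := L.quasisymmetric.inverse (strictMono_coe_units _) (strictMono_coe_units h)
    (CircleDeg1Lift.units_inv_apply_apply h)
  obtain ⟨M', hM'⟩ := (hM.add_const a).comp (strictMono_coe_units _) L'.quasisymmetric
    ((strictMono_coe_units h).add_const a)
  have hlift : ⇑(h'⁻¹ * CircleDeg1Lift.translate (Multiplicative.ofAdd a) * h : CircleDeg1Liftˣ) =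
      ⇑(h'⁻¹ : CircleDeg1Liftˣ) ∘ fun x => h x + a :=
    funext fun x => congrArg _ (add_comm a (h x))
  exact IsQuasisymmetricWith.isQuasisymmetric (hlift ▸ hM')
    (isLift_of_toCircleHomeo_apply_eq_add ha)

end Conjugacy

theorem isPowerLikeAt_one_of_deriv_pos {F : ℝ → ℝ} {x₀ : ℝ} (hF : ContDiffAt ℝ 2 F x₀)
    (hpos : 0 < deriv F x₀) : IsPowerLikeAt F x₀ 1 :=
  ⟨le_rfl, fun x => F x - F x₀, hF.sub contDiffAt_const, sub_self _, by rwa [deriv_sub_const],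
    Eventually.of_forall fun x => by rw [signedPow_one, add_sub_cancel]⟩

theorem strictMonoOn_of_strictMono_signedPow {F φ : ℝ → ℝ} {s : Set ℝ} {d k : ℝ} (hd : 1 ≤ d)
    (hF : StrictMono F) (h : ∀ x ∈ s, F x = k + signedPow d (φ x)) : StrictMonoOn φ s := by
  intro x hx y hy hxy
  have := hF hxy
  rwa [h x hx, h y hy, add_lt_add_iff_left, (strictMono_signedPow hd).lt_iff_lt] at this

theorem deriv_ne_zero_of_differentiableAt_symm {φ : OpenPartialHomeomorph ℝ ℝ} {x : ℝ}
    (hx : x ∈ φ.source) (hφ : DifferentiableAt ℝ φ x) (hsymm : DifferentiableAt ℝ φ.symm (φ x)) :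
    deriv φ x ≠ 0 := by
  intro hzero
  refine not_differentiableAt_of_local_left_inverse_hasDerivAt_zero (f := φ) ?_
    (φ.eventually_right_inverse (φ.map_source hx)) hsymm
  rw [φ.left_inv hx, ← hzero]
  exact hφ.hasDerivAt

theorem IsNonFlatCriticalPoint.isPowerLikeAt {F : ℝ → ℝ} (hF : StrictMono F) {c d : ℝ}
    (h : IsNonFlatCriticalPoint F c d) : IsPowerLikeAt F c d := by
  obtain ⟨-, hd, φ, hc, hφc, hφ, hsymm, heq⟩ := h
  have hnhds : φ.source ∈ 𝓝 c := φ.open_source.mem_nhds hc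
  have hφ' : ContDiffAt ℝ 3 φ c := hφ.contDiffAt hnhds
  have hsymm' : ContDiffAt ℝ 3 φ.symm (φ c) :=
    hsymm.contDiffAt (φ.open_target.mem_nhds (φ.map_source hc))
  have hmono := strictMonoOn_of_strictMono_signedPow hd.le hF heq
  have hnonneg : 0 ≤ deriv φ c := by
    rw [← derivWithin_of_mem_nhds hnhds]
    exact hmono.monotoneOn.derivWithin_nonneg
  have hne := deriv_ne_zero_of_differentiableAt_symm hc (hφ'.differentiableAt (by norm_num))
    (hsymm'.differentiableAt (by norm_num))
  exact ⟨hd.le, φ, hφ'.of_le (by norm_num), hφc, hnonneg.lt_of_ne' hne,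
    eventually_of_mem hnhds heq⟩

theorem IsMulticritical.isPowerLike {f : UnitAddCircle ≃ₜ UnitAddCircle} (hf : IsMulticritical f) :
    IsPowerLike f := by
  obtain ⟨F, hF, hsmooth, -, -, hcrit⟩ := hf
  refine ⟨F, hF, fun x => ?_⟩
  rcases hF.strictMono.monotone.deriv_nonneg.eq_or_lt with hzero | hpos
  · obtain ⟨d, hd⟩ := hcrit x hzero.symm
    exact ⟨d, hd.isPowerLikeAt hF.strictMono⟩
  · exact ⟨1, isPowerLikeAt_one_of_deriv_pos (hsmooth.contDiffAt.of_le (by norm_num)) hpos⟩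

end CircleMap

theorem mainTheorem6_general (f g : UnitAddCircle ≃ₜ UnitAddCircle)
    (hf : CircleMap.IsPowerLike f) (hg : CircleMap.IsPowerLike g)
    (hfg : CircleMap.rotationNumber f = CircleMap.rotationNumber g)
    (hirr : Irrational (CircleMap.rotationNumber f))
    (hbdd : CircleMap.IsBoundedType (CircleMap.rotationNumber f)) :
    (∃ h : UnitAddCircle ≃ₜ UnitAddCircle,
      CircleMap.IsConjugacy h f g ∧ CircleMap.IsQuasisymmetric h) ∧
    ∀ h : UnitAddCircle ≃ₜ UnitAddCircle,
      CircleMap.IsConjugacy h f g → CircleMap.IsQuasisymmetric h := by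
  obtain ⟨c₀, hc₀, hbad⟩ := hbdd.exists_badlyApproximableWith hirr
  obtain ⟨F, h, α, K, L⟩ := hf.exists_isLinearization hc₀ hbad
  obtain ⟨G, h', β, K', L'⟩ := hg.exists_isLinearization hc₀ (hfg ▸ hbad)
  have hαβ : (α : UnitAddCircle) = β :=
    CircleMap.coe_eq_coe_of_fract_eq (by rw [L.fract_eq, L'.fract_eq, hfg])
  have hα : Irrational α := by
    have : Irrational (Int.fract α) := L.fract_eq ▸ hirr
    exact Int.fract_add_floor α ▸ this.add_intCast _
  have hqs (k) (hk : CircleMap.IsConjugacy k f g) := L.isQuasisymmetric_of_isConjugacy L' hαβ hα hk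
  obtain ⟨k, hk⟩ := L.exists_isConjugacy L' hαβ
  exact ⟨⟨k, hk, hqs k hk⟩, hqs⟩

theorem mainTheorem6 (f g : UnitAddCircle ≃ₜ UnitAddCircle)
    (hf : CircleMap.IsMulticritical f) (hg : CircleMap.IsMulticritical g)
    (hfg : CircleMap.rotationNumber f = CircleMap.rotationNumber g)
    (hirr : Irrational (CircleMap.rotationNumber f))
    (hbdd : CircleMap.IsBoundedType (CircleMap.rotationNumber f)) :
    (∃ h : UnitAddCircle ≃ₜ UnitAddCircle,
      CircleMap.IsConjugacy h f g ∧ CircleMap.IsQuasisymmetric h) ∧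
    ∀ h : UnitAddCircle ≃ₜ UnitAddCircle,
      CircleMap.IsConjugacy h f g → CircleMap.IsQuasisymmetric h :=
  mainTheorem6_general f g hf.isPowerLike hg.isPowerLike hfg hirr hbdd
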